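/- A rooted tree is a finite tree with a distinguished vertex (the root), considered up to isomorphism; $\#T$ is the number of vertices of $T$, $\operatorname{aut}(T)$ is the cardinality of the automorphism group of $T$, and $\bullet$ is the tree with one vertex. For a field $K\supseteq\mathbb{Q}$ let $\widehat{PL}_K=\prod_{n\ge1}PL_n$, where $PL_n$ is the $K$-vector space spanned by the rooted trees with $n$ vertices, with the pre-Lie product $T\curvearrowleft T'$ = sum of all trees obtained from $T\sqcup T'$ by adding an edge from the root of $T'$ to a vertex of $T$. Its completed enveloping algebra $\widehat U(PL)_K$ consists of the formal series indexed by forests of rooted trees, with unit the empty forest, where the product $F\star F'$ is the sum of all forests obtained from $F\sqcup F'$ by adding edges (possibly none), each from some root of $F'$ to some vertex of $F$ (at most one edge for each root of $F'$). It acts on $\widehat{PL}_K$ on the right: $T\curvearrowleft F$ is the sum of all trees obtained from $T\sqcup F$ by attaching every root of $F$ to some vertex of $T$. Power series in elements of $\widehat{PL}_K$, such as $\exp$, are computed in $\widehat U(PL)_K$ for the product $\star$. For $A=\sum_n A_n\in\widehat{PL}_K$ with $A_n$ homogeneous of degree $n$, and $q\in K$, put $A[q]=\sum_n q^nA_n$.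 **Proposition.** There is a unique $\Omega\in\widehat{PL}_{\mathbb{Q}}$ with $$\bullet\curvearrowleft\frac{\Omega}{\exp(\Omega)-1}=\Omega,$$ and for this $\Omega$ there is a unique $\Omega_q\in\widehat{PL}_{\mathbb{Q}(q)}$ with $$\Omega_q[q]\curvearrowleft(\exp(\Omega)-1)+\Omega_q[q]-\Omega_q=\bullet\curvearrowleft\Omega_q+(q-1)\,\bullet .$$ The limit $\Omega_\infty$ of $\Omega_q[q]/q$ as $q\to\infty$ (coefficient by coefficient) exists in $\widehat{PL}_{\mathbb{Q}}$, and $$\Omega_\infty=\sum_T\frac{(-1)^{\#T-1}}{\operatorname{aut}(T)}\,T=\bullet\curvearrowleft\exp(-\Omega),$$ where the sum runs over all rooted trees $T$. -/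

import Mathlib

open Filter Topology

noncomputable section

namespace RootedTrees

/-- A rooted forest with vertex set `V`: each vertex is sent to the other end of its edge towards
the root (`none` at a root). Well-foundedness says that going towards the root always stops;
for finite `V` this is the absence of cycles. -/
structure LForest (V : Type) where
  parent : V → Option V
  wf : WellFounded fun u v => parent v = some u

namespace LForest

variable {V W U : Type}

/-- The roots of a forest. -/
abbrev Root (A : LForest V) : Type := {v : V // A.parent v = none}

/-- A rooted tree is a rooted forest with exactly one root. -/
def IsTree (A : LForest V) : Prop := ∃! v, A.parent v = none

/-- Isomorphisms of rooted forests. -/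
def Iso (A : LForest V) (B : LForest W) : Type :=
  {e : V ≃ W // ∀ v, B.parent (e v) = (A.parent v).map e}

theorem Iso.refl (A : LForest V) : Nonempty (Iso A A) :=
  ⟨⟨Equiv.refl V, fun v => by simp⟩⟩

theorem Iso.symm {A : LForest V} {B : LForest W} : Nonempty (Iso A B) → Nonempty (Iso B A) := by
  rintro ⟨e, he⟩
  refine ⟨⟨e.symm, fun w => ?_⟩⟩
  have h := he (e.symm w)
  rw [Equiv.apply_symm_apply] at h
  rw [h, Option.map_map]
  simp

theorem Iso.trans {A : LForest V} {B : LForest W} {C : LForest U} :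
    Nonempty (Iso A B) → Nonempty (Iso B C) → Nonempty (Iso A C) := by
  rintro ⟨e, he⟩ ⟨f, hf⟩
  refine ⟨⟨e.trans f, fun v => ?_⟩⟩
  simp [hf, he, Option.map_map, Function.comp_def]

/-- The parent map of `graft`. -/
def graftParent (A : LForest V) (B : LForest W) (s : B.Root → Option V) :
    V ⊕ W → Option (V ⊕ W)
  | Sum.inl v => (A.parent v).map Sum.inl
  | Sum.inr w =>
    match h : B.parent w with
    | some w' => some (Sum.inr w')
    | none => (s ⟨w, h⟩).map Sum.inl

/-- The forest obtained from the disjoint union of `A` and `B` by adding, for each root `r` of `B`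
with `s r = some v`, an edge from `r` to the vertex `v` of `A`. -/
def graft (A : LForest V) (B : LForest W) (s : B.Root → Option V) : LForest (V ⊕ W) where
  parent := graftParent A B s
  wf := by
    have hl : ∀ v : V, Acc (fun a b => graftParent A B s b = some a) (Sum.inl v) := by
      intro v
      induction v using A.wf.induction with
      | _ v ih =>
        refine Acc.intro _ fun y hy => ?_
        simp only [graftParent, Option.map_eq_some_iff] at hy
        obtain ⟨u, hu, rfl⟩ := hy
        exact ih u hu
    refine ⟨fun x => ?_⟩
    rcases x with v | w
    · exact hl v
    · induction w using B.wf.induction with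
      | _ w ih =>
        refine Acc.intro _ fun y hy => ?_
        simp only [graftParent] at hy
        split at hy
        · next w' h =>
          obtain rfl := Option.some.inj hy
          exact ih w' h
        · simp only [Option.map_eq_some_iff] at hy
          obtain ⟨u, -, rfl⟩ := hy
          exact hl u

theorem parent_injective : Function.Injective (parent : LForest V → V → Option V) := by
  rintro ⟨p, hp⟩ ⟨q, hq⟩ h
  cases h
  rfl

instance [Finite V] : Finite (LForest V) := Finite.of_injective _ parent_injective

/-- Isomorphism of forests on the vertex set `Fin n`. -/
instance setoid (n : ℕ) : Setoid (LForest (Fin n)) where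
  r A B := Nonempty (Iso A B)
  iseqv := ⟨Iso.refl, Iso.symm, Iso.trans⟩

end LForest

/-- Forests of (unlabeled) rooted trees with `n` vertices, i.e. isomorphism classes. -/
def Forest (n : ℕ) : Type := Quotient (LForest.setoid n)

instance (n : ℕ) : Finite (Forest n) := inferInstanceAs (Finite (Quotient (LForest.setoid n)))

instance (n : ℕ) : Fintype (Forest n) := Fintype.ofFinite _

/-- A representative of an isomorphism class. -/
def Forest.rep {n : ℕ} (F : Forest n) : LForest (Fin n) := Quotient.out F

/-- (Unlabeled) rooted trees with `n` vertices. -/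
def RTree (n : ℕ) : Type := {F : Forest n // F.rep.IsTree}

instance (n : ℕ) : Finite (RTree n) := inferInstanceAs (Finite {F : Forest n // F.rep.IsTree})

instance (n : ℕ) : Fintype (RTree n) := Fintype.ofFinite _

/-- A representative of a rooted tree. -/
def RTree.rep {n : ℕ} (T : RTree n) : LForest (Fin n) := T.1.rep

/-- The cardinality of the automorphism group of a rooted tree. -/
def aut {n : ℕ} (T : RTree n) : ℕ := Nat.card (LForest.Iso T.rep T.rep)

/-- The number of ways to obtain `H` from the disjoint union of `F` and `G` by adding some edges
(possibly none), each of them going from some root of `G` to some vertex of `F`. -/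
def starCount {i j n : ℕ} (F : Forest i) (G : Forest j) (H : Forest n) : ℕ :=
  Nat.card {s : G.rep.Root → Option (Fin i) //
    Nonempty (LForest.Iso (LForest.graft F.rep G.rep s) H.rep)}

/-- The number of ways to obtain the tree `S` from the disjoint union of the tree `T` and the
forest `G` by adding an edge from every root of `G` to some vertex of `T`. -/
def actCount {i j n : ℕ} (T : RTree i) (G : Forest j) (S : RTree n) : ℕ :=
  Nat.card {s : G.rep.Root → Fin i //
    Nonempty (LForest.Iso (LForest.graft T.rep G.rep (fun r => some (s r))) S.rep)}

/-- The completed free pre-Lie algebra on one generator over `K`, i.e. the product over `n` of the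
spaces spanned by the rooted trees with `n` vertices (there are none for `n = 0`).
`A n T` is the coefficient of `T` in `A`. -/
abbrev PLHat (K : Type) : Type := (n : ℕ) → RTree n → K

/-- The completed enveloping algebra of `PLHat K`, in its basis of forests. -/
abbrev UHat (K : Type) : Type := (n : ℕ) → Forest n → K

section Field

variable {K : Type} [Field K]

/-- The rooted tree with one vertex. -/
def dot : PLHat K := fun n _ => if n = 1 then 1 else 0

/-- The unit of the enveloping algebra: the empty forest. -/
def oneU : UHat K := fun n _ => if n = 0 then 1 else 0

open Classical in
/-- The inclusion of the completed free pre-Lie algebra into its enveloping algebra. -/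
def incl (A : PLHat K) : UHat K := fun n F => if h : F.rep.IsTree then A n ⟨F, h⟩ else 0

/-- The associative product `⋆` of the enveloping algebra. -/
def starMul (f g : UHat K) : UHat K := fun n H =>
  ∑ p ∈ Finset.HasAntidiagonal.antidiagonal n, ∑ F : Forest p.1, ∑ G : Forest p.2,
    f p.1 F * g p.2 G * (starCount F G H : K)

/-- The right action of the enveloping algebra on the completed free pre-Lie algebra: a forest `G`
acts on a tree `T` by the sum of all trees obtained by attaching every root of `G` to some
vertex of `T`. -/
def act (A : PLHat K) (g : UHat K) : PLHat K := fun n S =>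
  ∑ p ∈ Finset.HasAntidiagonal.antidiagonal n, ∑ T : RTree p.1, ∑ G : Forest p.2,
    A p.1 T * g p.2 G * (actCount T G S : K)

/-- The pre-Lie product: for trees, the sum of all trees obtained by adding an edge from the root
of the second one to some vertex of the first one. -/
def preLie (A B : PLHat K) : PLHat K := act A (incl B)

/-- Powers for the product `⋆`. -/
def starPow (f : UHat K) : ℕ → UHat K
  | 0 => oneU
  | k + 1 => starMul (starPow f k) f

/-- The series `∑ k, c_k A^k` in the enveloping algebra, for `φ = ∑ k, c_k x^k`. As `A` has no
component of degree `0`, the power `A^k` has no component of degree less than `k`. -/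
def powerSeriesAt (φ : PowerSeries K) (A : PLHat K) : UHat K := fun n F =>
  ∑ k ∈ Finset.range (n + 1), PowerSeries.coeff k φ * starPow (incl A) k n F

/-- The exponential of `A` in the completed enveloping algebra. -/
def expU [Algebra ℚ K] (A : PLHat K) : UHat K := powerSeriesAt (PowerSeries.exp K) A

/-- The element `A / (exp A - 1)` of the completed enveloping algebra; the power series
`x / (exp x - 1) = ∑ k, B_k / k! x^k` is Mathlib's `bernoulliPowerSeries`. -/
def bernoulliU [Algebra ℚ K] (A : PLHat K) : UHat K := powerSeriesAt (bernoulliPowerSeries K) A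

/-- The `q`-shift `A[q]`, multiplying the component of degree `n` by `q ^ n`. -/
def qShift (q : K) (A : PLHat K) : PLHat K := fun n T => q ^ n * A n T

end Field

/-- Extension of scalars from `ℚ` to `ℚ(q)`. -/
def toRatFunc (A : PLHat ℚ) : PLHat (RatFunc ℚ) := fun n T => algebraMap ℚ (RatFunc ℚ) (A n T)

/-- The equation `• ↶ (Ω / (exp Ω - 1)) = Ω` that defines the classical series `Ω`. -/
def IsOmega (Ω : PLHat ℚ) : Prop := act dot (bernoulliU Ω) = Ω

/-- The equation `Ω_q[q] ↶ (exp Ω - 1) + Ω_q[q] - Ω_q = • ↶ Ω_q + (q - 1) •` over `ℚ(q)` that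
defines the series `Ω_q`, where `Ω` is the classical series. -/
def IsOmegaQ (Ω : PLHat ℚ) (Ωq : PLHat (RatFunc ℚ)) : Prop :=
  act (qShift RatFunc.X Ωq) (expU (toRatFunc Ω) - oneU) + qShift RatFunc.X Ωq - Ωq
    = preLie dot Ωq + ((RatFunc.X : RatFunc ℚ) - 1) • dot

/-- The series `A` with coefficients in `ℚ(q)` has the limit `L` when `q` goes to infinity:
each coefficient, as a function of a real `q`, tends to the one of `L`. -/
def TendsToAtInfinity (A : PLHat (RatFunc ℚ)) (L : PLHat ℚ) : Prop :=
  ∀ (n : ℕ) (T : RTree n),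
    Tendsto (fun t : ℝ => RatFunc.eval (algebraMap ℚ ℝ) t (A n T)) atTop (𝓝 (L n T : ℝ))

end RootedTrees

end

open RootedTrees

/-! Weighting coefficients by automorphisms removes all multiplicities. Put `val f H` = |Aut H| ·
(coefficient of f at H). Counting in two ways the bijections that realise H as a grafting of G on F
gives `val_starMul`: (f ⋆ g)(H) is the sum of f(D) g(H \ D) over the lower sets D of H. Hence, for
fixed H, `incid H` turns ⋆ into the product of the incidence algebra of the lattice of lower sets. A
series of trees becomes a nilpotent element there, and power series in it become polynomials. The
action on trees is the tree part of ⋆.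

On a tree H, the equation of Ω says that • · β(a) and a have the same row ⊥, where a represents Ω
and β = x / (exp x - 1). Multiplying on the right by β⁻¹ shows that the tree part of exp Ω - 1 is •.
Since the exponential is multiplicative on disjoint unions (`val_expU_eq_mul`), exp Ω has weighted
value 1 on edgeless forests and 0 on all others (`IsOmega.val_expU`). Its inverse is the sum of
(-1)^#F F / aut F over all forests, because adding or removing a fixed leaf is a sign-reversing
involution (`sum_idl_alternating`); so this sum is exp(-Ω). Let L be the tree part of 1 - exp(-Ω),
which is the signed sum of trees. Replacing • by exp Ω - 1 gives • ↶ exp(-Ω) = L, and multiplying 1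
- exp(-Ω) by exp Ω gives L ↶ exp Ω = •.

For the limit, put B = Ω_q[q] / q. Degree n of the equation of Ω_q, divided by q, reads (1 - q⁻ⁿ) B
= • ↶ (Ω_q / q) + (1 - q⁻¹) • - B ↶ (exp Ω - 1). Degree j of Ω_q / q is q⁻ʲ Bⱼ, so it disappears in
the limit, leaving L + L ↶ (exp Ω - 1) = •, which the tree series above satisfies. Convergence
follows by induction on the degree. Existence and uniqueness of Ω and Ω_q hold because both
equations are triangular in the degree. -/

noncomputable section

namespace RootedTrees

namespace LForest

variable {V W U : Type}

/-! ### Isomorphisms and relabelings -/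

/-- Composition of isomorphisms. -/
def Iso.comp {A : LForest V} {B : LForest W} {C : LForest U} (f : Iso B C) (e : Iso A B) :
    Iso A C :=
  ⟨e.1.trans f.1, fun v => by simp [f.2, e.2, Option.map_map, Function.comp_def]⟩

/-- The inverse of an isomorphism. -/
def Iso.inv {A : LForest V} {B : LForest W} (e : Iso A B) : Iso B A :=
  ⟨e.1.symm, fun w => by
    obtain ⟨v, rfl⟩ := e.1.surjective w
    rw [e.2, Equiv.symm_apply_apply, Option.map_map]
    simp⟩

instance [Finite V] [Finite W] (A : LForest V) (B : LForest W) : Finite (Iso A B) :=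
  inferInstanceAs (Finite {e : V ≃ W // ∀ v, B.parent (e v) = (A.parent v).map e})

theorem Iso.parent_eq_some {A : LForest V} {B : LForest W} (e : Iso A B) {v u : V} :
    B.parent (e.1 v) = some (e.1 u) ↔ A.parent v = some u := by
  rw [e.2, Option.map_eq_some_iff]
  simp

theorem Iso.parent_eq_none {A : LForest V} {B : LForest W} (e : Iso A B) {v : V} :
    B.parent (e.1 v) = none ↔ A.parent v = none := by
  rw [e.2, Option.map_eq_none_iff]

/-- A bijection is an isomorphism as soon as it preserves and reflects the parent relation. -/
def Iso.ofIff {A : LForest V} {B : LForest W} (e : V ≃ W)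
    (h : ∀ v u, B.parent (e v) = some (e u) ↔ A.parent v = some u) : Iso A B :=
  ⟨e, fun v => by
    ext w
    obtain ⟨u, rfl⟩ := e.surjective w
    rw [h, Option.map_eq_some_iff]
    simp⟩

theorem Iso.card_right {A : LForest V} {B : LForest W} {C : LForest U} (f : Iso B C) :
    Nat.card (Iso A B) = Nat.card (Iso A C) :=
  Nat.card_congr
    { toFun := fun e => f.comp e
      invFun := fun e => f.inv.comp e
      left_inv := fun e => Subtype.ext (by ext; simp [Iso.comp, Iso.inv])
      right_inv := fun e => Subtype.ext (by ext; simp [Iso.comp, Iso.inv]) }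

theorem Iso.card_left {A : LForest V} {B : LForest W} {C : LForest U} (f : Iso A B) :
    Nat.card (Iso A C) = Nat.card (Iso B C) :=
  Nat.card_congr
    { toFun := fun e => e.comp f.inv
      invFun := fun e => e.comp f
      left_inv := fun e => Subtype.ext (by ext; simp [Iso.comp, Iso.inv])
      right_inv := fun e => Subtype.ext (by ext; simp [Iso.comp, Iso.inv]) }

theorem Iso.card_auto {A : LForest V} {B : LForest W} (f : Iso A B) :
    Nat.card (Iso A A) = Nat.card (Iso B B) :=
  f.card_right.trans f.card_left

theorem card_auto_pos [Finite V] (A : LForest V) : 0 < Nat.card (Iso A A) :=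
  have := Iso.refl A
  Nat.card_pos

theorem Iso.isTree {A : LForest V} {B : LForest W} (e : Iso A B) (h : A.IsTree) : B.IsTree := by
  obtain ⟨r, hr, hu⟩ := h
  refine ⟨e.1 r, e.parent_eq_none.2 hr, fun w hw => ?_⟩
  obtain ⟨v, rfl⟩ := e.1.surjective w
  rw [hu v (e.parent_eq_none.1 hw)]

/-- Transport of a forest along a bijection of the vertex sets. -/
def relabel (e : V ≃ W) (A : LForest V) : LForest W where
  parent w := (A.parent (e.symm w)).map e
  wf := by
    refine Subrelation.wf ?_ (InvImage.wf e.symm A.wf)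
    intro u v h
    obtain ⟨x, hx, rfl⟩ := Option.map_eq_some_iff.1 h
    simpa [InvImage] using hx

theorem relabel_iso (e : V ≃ W) (A : LForest V) : Nonempty (Iso A (A.relabel e)) :=
  ⟨⟨e, fun v => by simp [relabel]⟩⟩

/-! ### Restriction to a set of vertices -/

open Classical in
/-- The forest induced on a set of vertices. -/
def restrict (A : LForest V) (D : Set V) : LForest D where
  parent v := (A.parent v).bind fun u => if h : u ∈ D then some ⟨u, h⟩ else none
  wf := by
    refine Subrelation.wf ?_ (InvImage.wf Subtype.val A.wf)
    intro u v h
    obtain ⟨x, hx, hxu⟩ := Option.bind_eq_some_iff.1 h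
    split at hxu
    · obtain rfl := Option.some.inj hxu
      exact hx
    · cases hxu

theorem restrict_parent_eq_some {A : LForest V} {D : Set V} {v u : D} :
    (A.restrict D).parent v = some u ↔ A.parent v = some (u : V) := by
  simp only [restrict, Option.bind_eq_some_iff]
  constructor
  · rintro ⟨x, hx, h⟩
    split at h
    · obtain rfl := Option.some.inj h
      exact hx
    · cases h
  · intro h
    exact ⟨u, h, by simp⟩

theorem restrict_parent_eq_none {A : LForest V} {D : Set V} {v : D} :
    (A.restrict D).parent v = none ↔ ∀ u, A.parent v = some u → u ∉ D := by
  rw [Option.eq_none_iff_forall_ne_some]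
  constructor
  · intro h u hu hD
    exact h ⟨u, hD⟩ (restrict_parent_eq_some.2 hu)
  · intro h u hu
    exact h u (restrict_parent_eq_some.1 hu) u.2

/-- A set of vertices is lower if it contains the parents of its elements. -/
def IsLower (A : LForest V) (D : Set V) : Prop := ∀ ⦃v u⦄, A.parent v = some u → v ∈ D → u ∈ D

/-- The lower sets of vertices of a forest. -/
structure Idl (A : LForest V) where
  carrier : Set V
  lower : A.IsLower carrier

theorem Idl.carrier_injective (A : LForest V) :
    Function.Injective (Idl.carrier : Idl A → Set V) := by
  rintro ⟨D, hD⟩ ⟨E, hE⟩ h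
  cases h
  rfl

instance (A : LForest V) : PartialOrder (Idl A) :=
  PartialOrder.lift Idl.carrier (Idl.carrier_injective A)

instance [Finite V] (A : LForest V) : Finite (Idl A) :=
  Finite.of_injective _ (Idl.carrier_injective A)

instance [Finite V] (A : LForest V) : Fintype (Idl A) := Fintype.ofFinite _

instance (A : LForest V) : DecidableEq (Idl A) := Classical.decEq _

open Classical in
instance [Finite V] (A : LForest V) : LocallyFiniteOrder (Idl A) :=
  Fintype.toLocallyFiniteOrder

theorem restrict_univ_iso (A : LForest V) : Nonempty (Iso (A.restrict Set.univ) A) :=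
  ⟨Iso.ofIff (Equiv.Set.univ V) fun v u => by
    rw [restrict_parent_eq_some]; rfl⟩

/-! ### Counting graftings -/

theorem graft_parent_inl (A : LForest V) (B : LForest W) (s : B.Root → Option V) (v : V) :
    (graft A B s).parent (Sum.inl v) = (A.parent v).map Sum.inl := rfl

theorem graft_parent_inr_root (A : LForest V) (B : LForest W) (s : B.Root → Option V) {w : W}
    (h : B.parent w = none) :
    (graft A B s).parent (Sum.inr w) = (s ⟨w, h⟩).map Sum.inl := by
  simp only [graft, graftParent]
  split
  · next w' h' => rw [h] at h'; cases h'
  · rfl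

theorem graft_parent_inr_some (A : LForest V) (B : LForest W) (s : B.Root → Option V) {w w' : W}
    (h : B.parent w = some w') : (graft A B s).parent (Sum.inr w) = some (Sum.inr w') := by
  simp only [graft, graftParent]
  split
  · next w'' h' => rw [h] at h'; cases h'; rfl
  · next h' => rw [h] at h'; cases h'

/-- The bijections that are isomorphisms to `H` from some forest obtained by grafting `G` on `F`. -/
def IsGraftMap (F : LForest V) (G : LForest W) (H : LForest U) (e : V ⊕ W ≃ U) : Prop :=
  (∀ v, H.parent (e (Sum.inl v)) = (F.parent v).map fun u => e (Sum.inl u)) ∧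
  ∀ w w', H.parent (e (Sum.inr w)) = some (e (Sum.inr w')) ↔ G.parent w = some w'

theorem isGraftMap_of_iso {F : LForest V} {G : LForest W} {H : LForest U}
    {s : G.Root → Option V} (e : Iso (graft F G s) H) : IsGraftMap F G H e.1 := by
  refine ⟨fun v => ?_, fun w w' => ?_⟩
  · rw [e.2, graft_parent_inl, Option.map_map]; rfl
  · rw [e.parent_eq_some]
    cases h : G.parent w with
    | none => rw [graft_parent_inr_root _ _ _ h]; simp
    | some x => rw [graft_parent_inr_some _ _ _ h]; simp

theorem exists_iso_of_isGraftMap {F : LForest V} {G : LForest W} {H : LForest U}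
    {e : V ⊕ W ≃ U} (he : IsGraftMap F G H e) :
    ∃ (s : G.Root → Option V) (f : Iso (graft F G s) H), f.1 = e := by
  refine ⟨fun r => (H.parent (e (Sum.inr r.1))).bind fun u => (e.symm u).getLeft?, ⟨e, ?_⟩, rfl⟩
  rintro (v | w)
  · rw [graft_parent_inl, Option.map_map, he.1]; rfl
  · cases h : G.parent w with
    | some x => rw [graft_parent_inr_some _ _ _ h, (he.2 w x).2 h]; rfl
    | none =>
      rw [graft_parent_inr_root _ _ _ h]
      cases hp : H.parent (e (Sum.inr w)) with
      | none => simp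
      | some y =>
        obtain ⟨x | x, rfl⟩ := e.surjective y
        · simp
        · rw [he.2, h] at hp; cases hp

/-- The bijection alone determines `s`: the parent in `H` of the image of a root of `G` tells where
that root was grafted. -/
theorem card_sigma_graft_iso (F : LForest V) (G : LForest W) (H : LForest U) :
    Nat.card (Σ s : G.Root → Option V, Iso (graft F G s) H) =
      Nat.card {e : V ⊕ W ≃ U // IsGraftMap F G H e} := by
  refine Nat.card_eq_of_bijective (fun x => ⟨x.2.1, isGraftMap_of_iso x.2⟩) ⟨?_, ?_⟩
  · rintro ⟨s, e⟩ ⟨s', e'⟩ h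
    have he : e.1 = e'.1 := congrArg Subtype.val h
    have hs : s = s' := by
      funext r
      have h1 := e.2 (Sum.inr r.1)
      have h2 := e'.2 (Sum.inr r.1)
      rw [he, h2, graft_parent_inr_root _ _ _ r.2, graft_parent_inr_root _ _ _ r.2] at h1
      exact (Option.map_injective Sum.inl_injective
        (Option.map_injective e'.1.injective h1)).symm
    subst hs
    rw [Subtype.ext he]
  · rintro ⟨e, he⟩
    obtain ⟨s, f, rfl⟩ := exists_iso_of_isGraftMap he
    exact ⟨⟨s, f⟩, rfl⟩

open Classical in
/-- Two bijections onto a set and its complement glue to a bijection from the disjoint union. -/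
def glue {D : Set U} (e : V ≃ D) (f : W ≃ (Dᶜ : Set U)) : V ⊕ W ≃ U :=
  (Equiv.sumCongr e f).trans (Equiv.Set.sumCompl D)

@[simp] theorem glue_inl {D : Set U} (e : V ≃ D) (f : W ≃ (Dᶜ : Set U)) (v : V) :
    glue e f (Sum.inl v) = e v := by simp [glue]

@[simp] theorem glue_inr {D : Set U} (e : V ≃ D) (f : W ≃ (Dᶜ : Set U)) (w : W) :
    glue e f (Sum.inr w) = f w := by simp [glue]

theorem isGraftMap_glue {F : LForest V} {G : LForest W} {H : LForest U} (D : Idl H)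
    (e : Iso F (H.restrict D.1)) (f : Iso G (H.restrict D.1ᶜ)) :
    IsGraftMap F G H (glue e.1 f.1) := by
  refine ⟨fun v => ?_, fun w w' => ?_⟩
  · ext u
    rw [glue_inl, Option.map_eq_some_iff]
    constructor
    · intro h
      have hu : u ∈ D.1 := D.2 h (e.1 v).2
      obtain ⟨x, hx⟩ := e.1.surjective ⟨u, hu⟩
      refine ⟨x, e.parent_eq_some.1 (restrict_parent_eq_some.2 ?_), ?_⟩
      · rw [hx]; exact h
      · simp [hx]
    · rintro ⟨x, hx, rfl⟩
      rw [glue_inl]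
      exact restrict_parent_eq_some.1 (e.parent_eq_some.2 hx)
  · rw [glue_inr, glue_inr, ← restrict_parent_eq_some, f.parent_eq_some]

theorem exists_glue_of_isGraftMap {F : LForest V} {G : LForest W} {H : LForest U}
    {e : V ⊕ W ≃ U} (he : IsGraftMap F G H e) :
    ∃ (D : Idl H) (f : Iso F (H.restrict D.1)) (g : Iso G (H.restrict D.1ᶜ)),
      glue f.1 g.1 = e := by
  have hinl : Function.Injective fun v => e (Sum.inl v) := e.injective.comp Sum.inl_injective
  let D : Set U := Set.range fun v => e (Sum.inl v)
  have hD : H.IsLower D := by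
    rintro _ u hu ⟨v, rfl⟩
    rw [he.1, Option.map_eq_some_iff] at hu
    obtain ⟨x, -, rfl⟩ := hu
    exact ⟨x, rfl⟩
  have hc : ∀ w, e (Sum.inr w) ∈ Dᶜ := by
    rintro w ⟨v, hv⟩
    cases e.injective hv
  let f : V ≃ D := Equiv.ofInjective _ hinl
  let g : W ≃ (Dᶜ : Set U) := Equiv.ofBijective (fun w => ⟨e (Sum.inr w), hc w⟩) <| by
    constructor
    · intro w w' h
      exact Sum.inr_injective (e.injective (congrArg Subtype.val h))
    · rintro ⟨u, hu⟩
      obtain ⟨v | w, rfl⟩ := e.surjective u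
      · exact absurd ⟨v, rfl⟩ hu
      · exact ⟨w, rfl⟩
  refine ⟨⟨D, hD⟩, Iso.ofIff f fun v u => ?_, Iso.ofIff g fun w w' => ?_, ?_⟩
  · rw [restrict_parent_eq_some]
    change H.parent (e (Sum.inl v)) = some (e (Sum.inl u)) ↔ _
    rw [he.1, Option.map_eq_some_iff]
    simp
  · rw [restrict_parent_eq_some]
    exact he.2 w w'
  · ext x
    rcases x with v | w
    · exact glue_inl _ _ v
    · exact glue_inr _ _ w

/-- The image of `F` under such a bijection is a lower set of `H`, and the bijection is glued from
its restrictions to `F` and `G`. -/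
theorem card_sigma_idl_iso (F : LForest V) (G : LForest W) (H : LForest U) :
    Nat.card (Σ D : Idl H, Iso F (H.restrict D.1) × Iso G (H.restrict D.1ᶜ)) =
      Nat.card {e : V ⊕ W ≃ U // IsGraftMap F G H e} := by
  refine Nat.card_eq_of_bijective
    (fun x => ⟨glue x.2.1.1 x.2.2.1, isGraftMap_glue x.1 x.2.1 x.2.2⟩) ⟨?_, ?_⟩
  · rintro ⟨⟨D, hD⟩, e, f⟩ ⟨⟨D', hD'⟩, e', f'⟩ h
    have h : glue e.1 f.1 = glue e'.1 f'.1 := congrArg Subtype.val h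
    have hl : ∀ v, (e.1 v : U) = e'.1 v := fun v => by
      simpa using congrArg (fun k => k (Sum.inl v)) h
    have hr : ∀ v, (f.1 v : U) = f'.1 v := fun v => by
      simpa using congrArg (fun k => k (Sum.inr v)) h
    have hDD : D = D' := by
      ext u
      constructor
      · intro hu
        obtain ⟨v, hv⟩ := e.1.surjective ⟨u, hu⟩
        have := hl v
        rw [hv] at this
        change u = _ at this
        rw [this]
        exact (e'.1 v).2
      · intro hu
        obtain ⟨v, hv⟩ := e'.1.surjective ⟨u, hu⟩
        have := hl v
        rw [hv] at this
        change _ = u at this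
        rw [← this]
        exact (e.1 v).2
    subst hDD
    have he : e = e' := Subtype.ext (Equiv.ext fun v => Subtype.ext (hl v))
    have hf : f = f' := Subtype.ext (Equiv.ext fun v => Subtype.ext (hr v))
    rw [he, hf]
  · rintro ⟨e, he⟩
    obtain ⟨D, f, g, rfl⟩ := exists_glue_of_isGraftMap he
    exact ⟨⟨D, f, g⟩, rfl⟩

open Classical in
theorem card_iso_eq_ite (A : LForest V) (B : LForest W) :
    Nat.card (Iso A B) = if Nonempty (Iso A B) then Nat.card (Iso A A) else 0 := by
  split
  · next h => exact h.some.card_right.symm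
  · next h =>
    have := not_nonempty_iff.1 h
    exact Nat.card_of_isEmpty

open Classical in
/-- Graftings of `G` on `F` isomorphic to `H` correspond to the ways to cut `H` into `F` and `G`. -/
theorem card_graft_mul_card_auto [Finite V] [Finite W] [Finite U]
    (F : LForest V) (G : LForest W) (H : LForest U) :
    Nat.card {s : G.Root → Option V // Nonempty (Iso (graft F G s) H)} * Nat.card (Iso H H) =
      ∑ D : Idl H, (if Nonempty (Iso F (H.restrict D.1)) then Nat.card (Iso F F) else 0) *
        (if Nonempty (Iso G (H.restrict D.1ᶜ)) then Nat.card (Iso G G) else 0) := by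
  -- Two counts of the same bijections: each admissible `s` carries |Aut H| of them, each lower set
  -- carries the isomorphisms of the two pieces.
  have h := (card_sigma_graft_iso F G H).trans (card_sigma_idl_iso F G H).symm
  have := Fintype.ofFinite (G.Root → Option V)
  rw [Nat.card_sigma, Nat.card_sigma] at h
  simp only [Nat.card_prod] at h
  have h1 : ∀ D : Set U, Nat.card (Iso F (H.restrict D)) =
      if Nonempty (Iso F (H.restrict D)) then Nat.card (Iso F F) else 0 :=
    fun D => card_iso_eq_ite F _
  have h3 : ∀ D : Set U, Nat.card (Iso G (H.restrict D)) =
      if Nonempty (Iso G (H.restrict D)) then Nat.card (Iso G G) else 0 :=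
    fun D => card_iso_eq_ite G _
  simp only [h1, h3] at h
  rw [← h]
  have h2 : ∀ s : G.Root → Option V, Nat.card (Iso (graft F G s) H) =
      if Nonempty (Iso (graft F G s) H) then Nat.card (Iso H H) else 0 := by
    intro s
    split
    · next hs => exact hs.some.card_left
    · next hs =>
      have := not_nonempty_iff.1 hs
      exact Nat.card_of_isEmpty
  simp only [h2]
  rw [Finset.sum_ite, Finset.sum_const_zero, add_zero,
    Finset.sum_const, smul_eq_mul, Nat.card_eq_fintype_card, Fintype.card_subtype]

end LForest

open LForest

variable {K : Type} [Field K] {V W : Type}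

/-! ### Coefficients weighted by automorphisms -/

/-- The isomorphism class of a forest with an arbitrary finite set of vertices. -/
def LForest.toForest [Finite V] (A : LForest V) : Forest (Nat.card V) :=
  Quotient.mk (LForest.setoid _) (A.relabel (Finite.equivFin V))

theorem LForest.iso_toForest_rep [Finite V] (A : LForest V) : Nonempty (Iso A A.toForest.rep) := by
  refine Iso.trans (A.relabel_iso (Finite.equivFin V)) (Iso.symm ?_)
  exact Quotient.exact (Quotient.out_eq (Quotient.mk (LForest.setoid _) _))

theorem Forest.eq_of_iso {n : ℕ} {F G : Forest n} (h : Nonempty (Iso F.rep G.rep)) : F = G := by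
  rw [← Quotient.out_eq F, ← Quotient.out_eq G]
  exact Quotient.sound h

/-- The coefficient of `f` at a labeled forest, multiplied by the number of automorphisms. -/
def val [Finite V] (f : UHat K) (A : LForest V) : K :=
  (Nat.card (Iso A A) : K) * f (Nat.card V) A.toForest

theorem LForest.card_eq_of_iso {A : LForest V} {B : LForest W} (h : Nonempty (Iso A B)) :
    Nat.card V = Nat.card W :=
  Nat.card_congr h.some.1

theorem val_eq [Finite V] (f : UHat K) {A : LForest V} {n : ℕ} {F : Forest n}
    (h : Nonempty (Iso A F.rep)) : val f A = (Nat.card (Iso A A) : K) * f n F := by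
  obtain rfl : Nat.card V = n := by simpa using LForest.card_eq_of_iso h
  rw [val, Forest.eq_of_iso (Iso.trans (Iso.symm A.iso_toForest_rep) h)]

theorem val_congr [Finite V] [Finite W] (f : UHat K) {A : LForest V} {B : LForest W}
    (h : Nonempty (Iso A B)) : val f A = val f B := by
  rw [val_eq f (Iso.trans h B.iso_toForest_rep), val, h.some.card_auto]

theorem val_rep (f : UHat K) {n : ℕ} (F : Forest n) :
    val f F.rep = (Nat.card (Iso F.rep F.rep) : K) * f n F :=
  val_eq f (Iso.refl _)

theorem LForest.card_auto_ne_zero [CharZero K] [Finite V] (A : LForest V) :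
    (Nat.card (Iso A A) : K) ≠ 0 :=
  Nat.cast_ne_zero.2 A.card_auto_pos.ne'

theorem starCount_eq {i j : ℕ} [Finite V] (F : Forest i) (G : Forest j) (H : LForest V) :
    starCount F G H.toForest =
      Nat.card {s : G.rep.Root → Option (Fin i) // Nonempty (Iso (graft F.rep G.rep s) H)} :=
  Nat.card_congr <| Equiv.subtypeEquivRight fun _ =>
    ⟨fun h => Iso.trans h (Iso.symm H.iso_toForest_rep), fun h => Iso.trans h H.iso_toForest_rep⟩

open Classical in
theorem val_eq_sum [Finite V] (f : UHat K) (A : LForest V) :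
    val f A = ∑ F : Forest (Nat.card V),
      f _ F * (if Nonempty (Iso F.rep A) then Nat.card (Iso F.rep F.rep) else 0 : ℕ) := by
  rw [Finset.sum_eq_single A.toForest]
  · rw [if_pos (Iso.symm A.iso_toForest_rep), val, A.iso_toForest_rep.some.card_auto, mul_comm]
  · intro F _ hF
    rw [if_neg, Nat.cast_zero, mul_zero]
    exact fun h => hF (Forest.eq_of_iso (Iso.trans h A.iso_toForest_rep))
  · exact fun h => absurd (Finset.mem_univ _) h

-- Spreading the product over all bidegrees and all classes, with indicators, gives it the shape of
-- `starMul`, so that `val_starMul` is an exchange of sums.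
open Classical in
theorem val_mul_val_eq_sum [Finite V] [Finite W] (f g : UHat K) (A : LForest V) (B : LForest W)
    {n : ℕ} (hn : Nat.card V + Nat.card W = n) :
    val f A * val g B = ∑ p ∈ Finset.HasAntidiagonal.antidiagonal n,
      ∑ F : Forest p.1, ∑ G : Forest p.2, f p.1 F * g p.2 G *
        (((if Nonempty (Iso F.rep A) then Nat.card (Iso F.rep F.rep) else 0) *
          (if Nonempty (Iso G.rep B) then Nat.card (Iso G.rep G.rep) else 0) : ℕ) : K) := by
  rw [Finset.sum_eq_single (Nat.card V, Nat.card W)]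
  · rw [val_eq_sum, val_eq_sum, Finset.sum_mul_sum]
    refine Finset.sum_congr rfl fun F _ => Finset.sum_congr rfl fun G _ => ?_
    push_cast
    ring
  · rintro ⟨i, j⟩ hij hne
    refine Finset.sum_eq_zero fun F _ => Finset.sum_eq_zero fun G _ => ?_
    rw [Finset.HasAntidiagonal.mem_antidiagonal] at hij
    have : ¬ Nonempty (Iso F.rep A) := by
      intro h
      have hi : i = Nat.card V := by simpa using LForest.card_eq_of_iso h
      refine hne (Prod.ext hi ?_)
      simp only at hij hi ⊢
      omega
    rw [if_neg this]
    simp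
  · intro h
    exact absurd (Finset.HasAntidiagonal.mem_antidiagonal.2 hn) h

/-- In terms of weighted coefficients, the product `⋆` is a sum over the lower sets. -/
theorem val_starMul [Finite V] (f g : UHat K) (H : LForest V) :
    val (starMul f g) H = ∑ D : Idl H, val f (H.restrict D.1) * val g (H.restrict D.1ᶜ) := by
  classical
  have hcard : ∀ D : Set V, Nat.card D + Nat.card (Dᶜ : Set V) = Nat.card V := fun D => by
    rw [← Nat.card_sum]
    exact Nat.card_congr (Equiv.Set.sumCompl D)
  simp only [fun D : Set V => val_mul_val_eq_sum f g (H.restrict D) (H.restrict Dᶜ) (hcard D)]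
  rw [Finset.sum_comm, val, starMul, Finset.mul_sum]
  refine Finset.sum_congr rfl fun p _ => ?_
  rw [Finset.mul_sum]
  refine Eq.trans ?_ Finset.sum_comm
  refine Finset.sum_congr rfl fun F _ => ?_
  rw [Finset.mul_sum]
  refine Eq.trans ?_ Finset.sum_comm
  refine Finset.sum_congr rfl fun G _ => ?_
  rw [← Finset.mul_sum, ← Nat.cast_sum, ← card_graft_mul_card_auto, starCount_eq]
  push_cast
  ring

/-! ### The action in terms of the product -/

theorem LForest.exists_root [Nonempty V] (A : LForest V) : ∃ v, A.parent v = none := by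
  obtain ⟨v, -, hv⟩ := A.wf.has_min Set.univ Set.univ_nonempty
  exact ⟨v, Option.eq_none_iff_forall_ne_some.2 fun u hu => hv u trivial hu⟩

/-- Roots of `A` and ungrafted roots of `B` are all roots of the result, and `A` already has one. -/
theorem LForest.isTree_of_isTree_graft [Nonempty V] {A : LForest V} {B : LForest W}
    {s : B.Root → Option V} (h : (graft A B s).IsTree) : A.IsTree ∧ ∀ r, s r ≠ none := by
  obtain ⟨r, hr⟩ := A.exists_root
  have hr' : (graft A B s).parent (Sum.inl r) = none := by
    rw [graft_parent_inl, hr, Option.map_none]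
  refine ⟨⟨r, hr, fun v hv => ?_⟩, fun t ht => ?_⟩
  · have : (graft A B s).parent (Sum.inl v) = none := by rw [graft_parent_inl, hv, Option.map_none]
    exact Sum.inl_injective (h.unique this hr')
  · have : (graft A B s).parent (Sum.inr t.1) = none := by
      rw [graft_parent_inr_root _ _ _ t.2, ht, Option.map_none]
    cases h.unique this hr'

theorem LForest.not_isTree_of_isEmpty [IsEmpty V] (A : LForest V) : ¬ A.IsTree :=
  fun ⟨v, _⟩ => isEmptyElim v

instance : IsEmpty (RTree 0) := ⟨fun T => T.1.rep.not_isTree_of_isEmpty T.2⟩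

/-- As the result is a tree, no root of `G` can be left ungrafted. -/
theorem actCount_eq_starCount {i j n : ℕ} (T : RTree i) (G : Forest j) (S : RTree n) :
    actCount T G S = starCount T.1 G S.1 := by
  have : Nonempty (Fin i) := by
    by_contra h
    rw [not_nonempty_iff] at h
    exact T.1.rep.not_isTree_of_isEmpty T.2
  refine Nat.card_eq_of_bijective (fun s => ⟨fun r => some (s.1 r), s.2⟩) ⟨?_, ?_⟩
  · intro s t h
    have h := congrArg Subtype.val h
    exact Subtype.ext (funext fun r => Option.some_injective _ (congrFun h r))
  · rintro ⟨s, hs⟩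
    have hne := (isTree_of_isTree_graft ((Iso.symm hs).some.isTree S.2)).2
    choose t ht using fun r => Option.ne_none_iff_exists'.1 (hne r)
    obtain rfl : s = fun r => some (t r) := funext ht
    exact ⟨⟨t, hs⟩, rfl⟩

/-- The case `i = 0` is different: grafting on the empty forest returns `G`, which may be a tree. -/
theorem starCount_eq_zero {i j n : ℕ} {F : Forest i} (G : Forest j) (S : RTree n) (hi : i ≠ 0)
    (hF : ¬ F.rep.IsTree) : starCount F G S.1 = 0 := by
  have : Nonempty (Fin i) := ⟨⟨0, Nat.pos_of_ne_zero hi⟩⟩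
  have : IsEmpty {s : G.rep.Root → Option (Fin i) //
      Nonempty (Iso (graft F.rep G.rep s) S.1.rep)} :=
    ⟨fun s => hF (isTree_of_isTree_graft ((Iso.symm s.2).some.isTree S.2)).1⟩
  exact Nat.card_of_isEmpty

/-- The projection of the enveloping algebra to the span of the trees. -/
def treePart (f : UHat K) : PLHat K := fun n T => f n T.1

theorem treePart_incl (A : PLHat K) : treePart (incl A) = A := by
  funext n T
  exact dif_pos T.2

theorem incl_zero (A : PLHat K) (F : Forest 0) : incl A 0 F = 0 :=
  dif_neg F.rep.not_isTree_of_isEmpty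

/-- A nonempty forest that is not a tree never yields a tree, and `hf` excludes the empty one.
Identities for the action thus reduce to identities for ⋆. -/
theorem act_treePart {f : UHat K} (hf : ∀ F, f 0 F = 0) (g : UHat K) :
    act (treePart f) g = treePart (starMul f g) := by
  funext n S
  refine Finset.sum_congr rfl fun p _ => ?_
  refine Fintype.sum_of_injective (fun T : RTree p.1 => T.1) Subtype.val_injective _ _ ?_ ?_
  · intro F hF
    refine Finset.sum_eq_zero fun G _ => ?_
    rcases p with ⟨i, j⟩
    rcases eq_or_ne i 0 with rfl | hi
    · rw [hf, zero_mul, zero_mul]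
    · rw [starCount_eq_zero G S hi fun h => hF ⟨⟨F, h⟩, rfl⟩, Nat.cast_zero, mul_zero]
  · intro T
    refine Finset.sum_congr rfl fun G _ => ?_
    rw [actCount_eq_starCount]
    rfl

theorem act_eq_treePart (A : PLHat K) (g : UHat K) : act A g = treePart (starMul (incl A) g) := by
  rw [← act_treePart (incl_zero A), treePart_incl]

theorem val_incl_of_not_isTree [Finite V] (A : PLHat K) {H : LForest V} (h : ¬ H.IsTree) :
    val (incl A) H = 0 := by
  rw [val, incl, dif_neg, mul_zero]
  exact fun h' => h ((Iso.symm H.iso_toForest_rep).some.isTree h')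

theorem val_incl_eq [Finite V] (A : PLHat K) {H : LForest V} {n : ℕ} {T : RTree n}
    (h : Nonempty (Iso H T.rep)) : val (incl A) H = (aut T : K) * A n T := by
  rw [val_eq _ h, h.some.card_auto, incl, dif_pos T.2]
  rfl

theorem LForest.IsTree.exists_rTree [Finite V] {H : LForest V} (h : H.IsTree) :
    ∃ T : RTree (Nat.card V), Nonempty (Iso H T.rep) :=
  ⟨⟨H.toForest, H.iso_toForest_rep.some.isTree h⟩, H.iso_toForest_rep⟩

theorem val_incl_treePart [Finite V] (f : UHat K) {H : LForest V} (h : H.IsTree) :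
    val (incl (treePart f)) H = val f H := by
  obtain ⟨T, hT⟩ := h.exists_rTree
  rw [val_incl_eq _ hT, val_eq f hT, hT.some.card_auto]
  rfl

theorem pLHat_ext [CharZero K] {A B : PLHat K}
    (h : ∀ (n : ℕ) (H : LForest (Fin n)), H.IsTree → val (incl A) H = val (incl B) H) : A = B := by
  funext n T
  have := h n T.rep T.2
  rw [val_incl_eq A (Iso.refl _), val_incl_eq B (Iso.refl _)] at this
  exact mul_left_cancel₀ (LForest.card_auto_ne_zero T.rep) this

theorem aut_eq [Finite V] {H : LForest V} {n : ℕ} {T : RTree n}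
    (h : Nonempty (Iso H T.rep)) : aut T = Nat.card (Iso H H) :=
  h.some.card_auto.symm

/-! ### Power series evaluated at nilpotent elements -/

/-- A polynomial and its truncation differ by a multiple of `X ^ N`, which `a` annihilates. -/
theorem aeval_trunc_coe {R S : Type*} [CommRing R] [Ring S] [Algebra R S] {a : S} {N : ℕ}
    (ha : a ^ N = 0) (p : Polynomial R) :
    Polynomial.aeval a (PowerSeries.trunc N (p : PowerSeries R)) = Polynomial.aeval a p := by
  have hdvd : (Polynomial.X : Polynomial R) ^ N ∣
      p - PowerSeries.trunc N (p : PowerSeries R) := by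
    rw [Polynomial.X_pow_dvd_iff]
    intro d hd
    rw [Polynomial.coeff_sub, PowerSeries.coeff_trunc, if_pos hd, Polynomial.coeff_coe, sub_self]
  obtain ⟨r, hr⟩ := hdvd
  have := congrArg (Polynomial.aeval a) hr
  rw [map_sub, map_mul, map_pow, Polynomial.aeval_X, ha, zero_mul, sub_eq_zero] at this
  exact this.symm

theorem aeval_trunc_mul {R S : Type*} [CommRing R] [Ring S] [Algebra R S] {a : S} {N : ℕ}
    (ha : a ^ N = 0) (φ ψ : PowerSeries R) :
    Polynomial.aeval a (PowerSeries.trunc N (φ * ψ)) =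
      Polynomial.aeval a (PowerSeries.trunc N φ) * Polynomial.aeval a (PowerSeries.trunc N ψ) := by
  rw [← PowerSeries.trunc_trunc_mul_trunc, ← Polynomial.coe_mul, aeval_trunc_coe ha, map_mul]

theorem aeval_trunc_eq_sum {R S : Type*} [CommRing R] [Ring S] [Algebra R S] (a : S) (N : ℕ)
    (φ : PowerSeries R) :
    Polynomial.aeval a (PowerSeries.trunc (N + 1) φ) =
      ∑ k ∈ Finset.range (N + 1), PowerSeries.coeff k φ • a ^ k := by
  rw [Polynomial.aeval_eq_sum_range' (PowerSeries.natDegree_trunc_lt φ N)]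
  refine Finset.sum_congr rfl fun k hk => ?_
  rw [PowerSeries.coeff_trunc, if_pos (Finset.mem_range.1 hk)]

/-! ### The incidence algebra of the lower sets of a forest -/

/-- A nonzero term of the `k`-th power runs along a strict chain of `k` steps, along which `r` grows
by at least `k`. -/
theorem incidence_pow_apply_eq_zero {α : Type*} [PartialOrder α] [LocallyFiniteOrder α]
    [DecidableEq α] {R : Type*} [Semiring R] {a : IncidenceAlgebra R α} (ha : ∀ x, a x x = 0)
    {r : α → ℕ} (hr : StrictMono r) (k : ℕ) : ∀ x y, r y < r x + k → (a ^ k) x y = 0 := by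
  induction k with
  | zero =>
    intro x y h
    rw [pow_zero, IncidenceAlgebra.one_apply, if_neg]
    rintro rfl
    omega
  | succ k ih =>
    intro x y h
    rw [pow_succ, IncidenceAlgebra.mul_apply]
    refine Finset.sum_eq_zero fun z hz => ?_
    rcases (Finset.mem_Icc.1 hz).2.eq_or_lt with rfl | hzy
    · rw [ha, mul_zero]
    · have := hr hzy
      rw [ih x z (by omega), zero_mul]

open Classical in
/-- The element of the incidence algebra whose value at `I ≤ J` is the weighted coefficient of `f`
at the forest induced on `J \ I`. -/
def incid [Finite V] (H : LForest V) (f : UHat K) : IncidenceAlgebra K (Idl H) where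
  toFun I J := if I ≤ J then val f (H.restrict (J.1 \ I.1)) else 0
  eq_zero_of_not_le' _ _ h := if_neg h

theorem incid_apply [Finite V] {H : LForest V} (f : UHat K) {I J : Idl H} (h : I ≤ J) :
    incid H f I J = val f (H.restrict (J.1 \ I.1)) := if_pos h

theorem LForest.restrict_restrict_iso (H : LForest V) (E : Set V) (D : Set E) :
    Nonempty (Iso ((H.restrict E).restrict D) (H.restrict (Subtype.val '' D))) :=
  ⟨Iso.ofIff (Equiv.Set.image Subtype.val D Subtype.val_injective) fun v u => by
    rw [restrict_parent_eq_some, restrict_parent_eq_some, restrict_parent_eq_some]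
    rfl⟩

theorem val_restrict_congr [Finite V] (f : UHat K) (H : LForest V) {D E : Set V} (h : D = E) :
    val f (H.restrict D) = val f (H.restrict E) := by
  subst h
  rfl

/-- The lower sets `D` of the forest on `J \ I` correspond to the elements `I ∪ D` of the interval
from `I` to `J`. -/
theorem incid_starMul [Finite V] (H : LForest V) (f g : UHat K) :
    incid H (starMul f g) = incid H f * incid H g := by
  refine IncidenceAlgebra.ext fun I J hIJ => ?_
  have hIJ' : I.1 ⊆ J.1 := hIJ
  rw [incid_apply _ hIJ, val_starMul, IncidenceAlgebra.mul_apply]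
  refine Finset.sum_bij'
    (fun D _ => ⟨I.1 ∪ Subtype.val '' D.1, ?_⟩)
    (fun M _ => ⟨Subtype.val ⁻¹' M.1, ?_⟩) ?_ ?_ ?_ ?_ ?_
  · rintro v u h (hv | ⟨v, hv, rfl⟩)
    · exact Or.inl (I.2 h hv)
    · by_cases hu : u ∈ I.1
      · exact Or.inl hu
      · have huJ : u ∈ J.1 \ I.1 := ⟨J.2 h v.2.1, hu⟩
        refine Or.inr ⟨⟨u, huJ⟩, D.2 (restrict_parent_eq_some.2 h) hv, rfl⟩
  · intro v u h hv
    exact M.2 (restrict_parent_eq_some.1 h) hv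
  · intro D _
    refine Finset.mem_Icc.2 ⟨Set.subset_union_left, Set.union_subset hIJ' ?_⟩
    rintro _ ⟨v, -, rfl⟩
    exact v.2.1
  · exact fun _ _ => Finset.mem_univ _
  · intro D _
    refine Idl.carrier_injective _ ?_
    ext v
    simp [v.2.2]
  · intro M hM
    obtain ⟨h1, h2⟩ := Finset.mem_Icc.1 hM
    refine Idl.carrier_injective _ ?_
    ext v
    have h1' := @h1 v
    have h2' := @h2 v
    simp only [Set.mem_union, Set.mem_image, Set.mem_preimage, Subtype.exists, exists_and_left,
      exists_prop, exists_eq_right_right, Set.mem_sdiff]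
    tauto
  · intro D _
    have hM : I.1 ⊆ I.1 ∪ Subtype.val '' D.1 := Set.subset_union_left
    have hJ : I.1 ∪ Subtype.val '' D.1 ⊆ J.1 := Set.union_subset hIJ' (by
      rintro _ ⟨v, -, rfl⟩
      exact v.2.1)
    rw [incid_apply _ hM, incid_apply _ hJ, val_congr f (H.restrict_restrict_iso _ _),
      val_congr g (H.restrict_restrict_iso _ _)]
    have e1 : (I.1 ∪ Subtype.val '' D.1) \ I.1 = Subtype.val '' D.1 := by
      ext v
      simp only [Set.mem_sdiff, Set.mem_union, Set.mem_image, Subtype.exists, exists_and_right,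
        exists_eq_right]
      constructor
      · rintro ⟨h | h, h'⟩
        · exact absurd h h'
        · exact h
      · rintro ⟨h, h'⟩
        exact ⟨Or.inr ⟨h, h'⟩, h.2⟩
    have e2 : J.1 \ (I.1 ∪ Subtype.val '' D.1) = Subtype.val '' D.1ᶜ := by
      ext v
      simp only [Set.mem_sdiff, Set.mem_union, Set.mem_image, Subtype.exists, exists_and_right,
        exists_eq_right, Set.mem_compl_iff, not_or, not_exists]
      constructor
      · rintro ⟨h, h', h''⟩
        exact ⟨⟨h, h'⟩, h'' ⟨h, h'⟩⟩
      · rintro ⟨h, h'⟩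
        exact ⟨h.1, h.2, fun _ => h'⟩
    exact congrArg₂ (· * ·) (val_restrict_congr f H e1.symm) (val_restrict_congr g H e2.symm)

theorem val_oneU_of_isEmpty [Finite V] [IsEmpty V] (A : LForest V) : val (oneU : UHat K) A = 1 := by
  have : Subsingleton (Iso A A) := ⟨fun e f => Subtype.ext (Equiv.ext fun v => isEmptyElim v)⟩
  have : Nonempty (Iso A A) := Iso.refl A
  simp [val, oneU]

theorem val_oneU_of_nonempty [Finite V] [Nonempty V] (A : LForest V) :
    val (oneU : UHat K) A = 0 := by
  rw [val, oneU, if_neg Nat.card_pos.ne', mul_zero]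

theorem incid_oneU [Finite V] (H : LForest V) : incid H (oneU : UHat K) = 1 := by
  refine IncidenceAlgebra.ext fun I J hIJ => ?_
  rw [incid_apply _ hIJ, IncidenceAlgebra.one_apply]
  split
  · next h =>
    subst h
    have : IsEmpty ↥(I.1 \ I.1) := by simp
    exact val_oneU_of_isEmpty _
  · next h =>
    have : Nonempty ↥(J.1 \ I.1) := by
      rw [Set.nonempty_coe_sort, Set.sdiff_nonempty]
      exact fun h' => h (le_antisymm hIJ h')
    exact val_oneU_of_nonempty _

theorem incid_starPow [Finite V] (H : LForest V) (f : UHat K) (k : ℕ) :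
    incid H (starPow f k) = incid H f ^ k := by
  induction k with
  | zero => rw [starPow, incid_oneU, pow_zero]
  | succ k ih => rw [starPow, incid_starMul, ih, pow_succ]

theorem incid_incl_self [Finite V] (H : LForest V) (A : PLHat K) (I : Idl H) :
    incid H (incl A) I I = 0 := by
  have : IsEmpty ↥(I.1 \ I.1) := by simp
  rw [incid_apply _ le_rfl]
  exact val_incl_of_not_isTree A (not_isTree_of_isEmpty _)

theorem LForest.Idl.strictMono_ncard [Finite V] (H : LForest V) :
    StrictMono fun I : Idl H => I.1.ncard :=
  fun _ _ h => Set.ncard_lt_ncard h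

theorem incid_incl_pow_apply_eq_zero [Finite V] (H : LForest V) (A : PLHat K) {k : ℕ} {I J : Idl H}
    (h : J.1.ncard < I.1.ncard + k) : (incid H (incl A) ^ k) I J = 0 :=
  incidence_pow_apply_eq_zero (incid_incl_self H A) (Idl.strictMono_ncard H) k I J h

theorem incid_incl_pow_eq_zero [Finite V] (H : LForest V) (A : PLHat K) :
    incid H (incl A) ^ (Nat.card V + 1) = 0 := by
  refine IncidenceAlgebra.ext fun I J _ => incid_incl_pow_apply_eq_zero H A ?_
  have := Set.ncard_le_card J.1
  omega

theorem val_powerSeriesAt [Finite V] (φ : PowerSeries K) (A : PLHat K) (H : LForest V) :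
    val (powerSeriesAt φ A) H =
      ∑ k ∈ Finset.range (Nat.card V + 1), PowerSeries.coeff k φ * val (starPow (incl A) k) H := by
  simp only [val, powerSeriesAt, Finset.mul_sum]
  exact Finset.sum_congr rfl fun k _ => by ring

/-- Power series in the enveloping algebra become power series in the incidence algebra. -/
theorem incid_powerSeriesAt [Finite V] (H : LForest V) (φ : PowerSeries K) (A : PLHat K) :
    incid H (powerSeriesAt φ A) =
      Polynomial.aeval (incid H (incl A)) (PowerSeries.trunc (Nat.card V + 1) φ) := by
  refine IncidenceAlgebra.ext fun I J hIJ => ?_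
  have hcard : Nat.card ↥(J.1 \ I.1) + I.1.ncard = J.1.ncard :=
    Set.ncard_sdiff_add_ncard_of_subset hIJ
  have hsum : ∀ s : Finset ℕ,
      (∑ k ∈ s, PowerSeries.coeff k φ • incid H (incl A) ^ k : IncidenceAlgebra K (Idl H)) I J =
        ∑ k ∈ s, PowerSeries.coeff k φ * (incid H (incl A) ^ k) I J := by
    intro s
    induction s using Finset.induction_on with
    | empty => simp
    | insert k s hk ih =>
      rw [Finset.sum_insert hk, Finset.sum_insert hk, IncidenceAlgebra.add_apply, ih]
      rfl
  rw [incid_apply _ hIJ, val_powerSeriesAt, aeval_trunc_eq_sum, hsum]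
  have hle : Nat.card ↥(J.1 \ I.1) + 1 ≤ Nat.card V + 1 := by
    have := Set.ncard_le_card J.1
    omega
  -- The entry at `(I, J)` only involves powers up to |J \ I|; the others, up to the common bound
  -- |V|, vanish at that entry.
  rw [← Finset.sum_subset (Finset.range_mono hle)]
  · refine Finset.sum_congr rfl fun k _ => ?_
    rw [← incid_starPow, incid_apply _ hIJ]
  · intro k _ hk
    rw [Finset.mem_range] at hk
    rw [incid_incl_pow_apply_eq_zero H A (by omega), mul_zero]

/-! ### The empty lower set and the full one -/

instance (H : LForest V) : OrderBot (Idl H) where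
  bot := ⟨∅, fun _ _ _ h => h⟩
  bot_le _ := Set.empty_subset _

instance (H : LForest V) : OrderTop (Idl H) where
  top := ⟨Set.univ, fun _ _ _ _ => trivial⟩
  le_top _ := Set.subset_univ _

theorem LForest.Idl.bot_carrier (H : LForest V) : (⊥ : Idl H).1 = ∅ := rfl

theorem LForest.Idl.top_carrier (H : LForest V) : (⊤ : Idl H).1 = Set.univ := rfl

theorem incid_bot [Finite V] {H : LForest V} (f : UHat K) (J : Idl H) :
    incid H f ⊥ J = val f (H.restrict J.1) := by
  rw [incid_apply _ bot_le]
  exact val_restrict_congr f H Set.sdiff_empty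

theorem incid_top [Finite V] {H : LForest V} (f : UHat K) (I : Idl H) :
    incid H f I ⊤ = val f (H.restrict I.1ᶜ) := by
  rw [incid_apply _ le_top]
  exact val_restrict_congr f H (Set.compl_eq_univ_sdiff _).symm

theorem incid_bot_top [Finite V] (H : LForest V) (f : UHat K) : incid H f ⊥ ⊤ = val f H := by
  rw [incid_bot, Idl.top_carrier, val_congr f H.restrict_univ_iso]

/-- Restricting to a lower set cuts no edge going to a parent, so it creates no new root. -/
theorem LForest.IsTree.restrict {H : LForest V} (h : H.IsTree) (J : Idl H) (hJ : J.1.Nonempty) :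
    (H.restrict J.1).IsTree := by
  have := hJ.to_subtype
  have key : ∀ v : J.1, (H.restrict J.1).parent v = none → H.parent v = none := fun v hv =>
    Option.eq_none_iff_forall_ne_some.2 fun u hu =>
      restrict_parent_eq_none.1 hv u hu (J.2 hu v.2)
  obtain ⟨r, hr⟩ := (H.restrict J.1).exists_root
  exact ⟨r, hr, fun v hv => Subtype.ext (h.unique (key v hv) (key r hr))⟩

/-- Row ⊥ only sees nonempty lower sets of a tree, which are trees, and the empty one, handled by
`hf`. In other rows the projection to trees may lose terms, so the action is controlled in this row
only. -/
theorem incid_incl_treePart_bot [Finite V] {H : LForest V} (h : H.IsTree) (f : UHat K)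
    (hf : ∀ F, f 0 F = 0) (J : Idl H) : incid H (incl (treePart f)) ⊥ J = incid H f ⊥ J := by
  rw [incid_bot, incid_bot]
  rcases J.1.eq_empty_or_nonempty with hJ | hJ
  · have hc : Nat.card J.1 = 0 := by simp [hJ]
    have : IsEmpty J.1 := by simp [hJ]
    rw [val_incl_of_not_isTree _ (not_isTree_of_isEmpty _)]
    have h0 : ∀ n, n = 0 → ∀ F : Forest n, f n F = 0 := by
      rintro _ rfl
      exact hf
    rw [val, h0 _ hc, mul_zero]
  · exact val_incl_treePart f (h.restrict J hJ)

theorem starMul_zero {f : UHat K} (hf : ∀ F, f 0 F = 0) (g : UHat K) (H : Forest 0) :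
    starMul f g 0 H = 0 := by
  refine Finset.sum_eq_zero fun p hp => Finset.sum_eq_zero fun F _ =>
    Finset.sum_eq_zero fun G _ => ?_
  obtain ⟨i, j⟩ := p
  obtain rfl : i = 0 := by
    have := Finset.HasAntidiagonal.mem_antidiagonal.1 hp
    simp only at this
    omega
  rw [hf, zero_mul, zero_mul]

theorem incid_incl_act_bot [Finite V] {H : LForest V} (h : H.IsTree) (A : PLHat K) (g : UHat K)
    (J : Idl H) : incid H (incl (act A g)) ⊥ J = (incid H (incl A) * incid H g) ⊥ J := by
  rw [act_eq_treePart, incid_incl_treePart_bot h _ (starMul_zero (incl_zero A) g), incid_starMul]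

theorem val_incl_dot [Finite V] {H : LForest V} (h : H.IsTree) :
    val (incl dot : UHat K) H = if Nat.card V = 1 then 1 else 0 := by
  obtain ⟨T, hT⟩ := h.exists_rTree
  rw [val_incl_eq _ hT, dot]
  split
  · next h1 =>
    have := (Nat.card_eq_one_iff_unique.1 h1).1
    have : Subsingleton (Iso H H) :=
      ⟨fun e f => Subtype.ext (Equiv.ext fun v => Subsingleton.elim _ _)⟩
    have := Iso.refl H
    rw [aut_eq hT, Nat.card_unique, Nat.cast_one, mul_one]
  · rw [mul_zero]

/-- The exponential of `Ω` has no other trees than `•`. -/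
theorem IsOmega.val_expU_of_isTree [Finite V] {Ω : PLHat ℚ} (hΩ : IsOmega Ω) {H : LForest V}
    (h : H.IsTree) : val (expU Ω) H = if Nat.card V = 1 then 1 else 0 := by
  set N := Nat.card V
  set a := incid H (incl Ω)
  have ha : a ^ (N + 1) = 0 := incid_incl_pow_eq_zero H Ω
  -- `γ` is (exp x - 1) / x, the inverse of the Bernoulli series.
  obtain ⟨γ, hγ⟩ : (PowerSeries.X : PowerSeries ℚ) ∣ PowerSeries.exp ℚ - 1 := by
    rw [PowerSeries.X_dvd_iff]
    simp
  have hβγ : bernoulliPowerSeries ℚ * γ = 1 := by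
    have h1 := bernoulliPowerSeries_mul_exp_sub_one ℚ
    rw [hγ, mul_left_comm] at h1
    exact mul_left_cancel₀ PowerSeries.X_ne_zero (h1.trans (mul_one _).symm)
  let ev : PowerSeries ℚ → IncidenceAlgebra ℚ (Idl H) := fun φ =>
    Polynomial.aeval a (PowerSeries.trunc (N + 1) φ)
  have hev : ∀ φ, incid H (powerSeriesAt φ Ω) = ev φ := fun φ => incid_powerSeriesAt H φ Ω
  have ev_one : ev 1 = 1 := by simp [ev]
  have ev_X : ev PowerSeries.X = a := by
    have : NeZero N := ⟨by
      obtain ⟨r, -⟩ := h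
      have : Nonempty V := ⟨r⟩
      exact Nat.card_pos.ne'⟩
    rw [← Polynomial.coe_X]
    exact (aeval_trunc_coe ha Polynomial.X).trans (Polynomial.aeval_X a)
  have ev_mul : ∀ φ ψ, ev (φ * ψ) = ev φ * ev ψ := aeval_trunc_mul ha
  have row : ∀ J, (incid H (incl dot) * ev (bernoulliPowerSeries ℚ) :
      IncidenceAlgebra ℚ (Idl H)) ⊥ J = a ⊥ J := by
    intro J
    rw [← hev, ← incid_incl_act_bot h]
    exact congrArg (fun A => incid H (incl A) ⊥ J) hΩ
  -- Right multiplication acts on each row separately, so equality in row ⊥ suffices.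
  have row' : (incid H (incl dot) * ev (bernoulliPowerSeries ℚ) * ev γ :
      IncidenceAlgebra ℚ (Idl H)) ⊥ ⊤ = (a * ev γ) ⊥ ⊤ := by
    rw [IncidenceAlgebra.mul_apply, IncidenceAlgebra.mul_apply]
    exact Finset.sum_congr rfl fun J _ => by rw [row]
  rw [mul_assoc, ← ev_mul, hβγ, ev_one, mul_one, incid_bot_top, val_incl_dot h] at row'
  have hsub : a * ev γ = incid H (expU Ω) - 1 := by
    rw [← ev_X, ← ev_mul, ← hγ, expU, hev, ← ev_one]
    simp only [ev, map_sub]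
  have hne : (⊥ : Idl H) ≠ ⊤ := by
    obtain ⟨r, -⟩ := h
    intro h'
    have : r ∈ (⊤ : Idl H).1 := trivial
    rw [← h'] at this
    exact this
  rw [row', hsub, IncidenceAlgebra.sub_apply, IncidenceAlgebra.one_apply, if_neg hne, sub_zero,
    incid_bot_top]

/-! ### Multiplicativity of the exponential -/

open Classical in
/-- The ring endomorphism of the incidence algebra that keeps the values at the pairs `I ≤ J` with
`J \ I` contained in a given set. -/
def mask [Finite V] (H : LForest V) (A : Set V) :
    IncidenceAlgebra K (Idl H) →+* IncidenceAlgebra K (Idl H) where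
  toFun a := ⟨fun I J => if J.1 \ I.1 ⊆ A then a I J else 0, fun I J h => by
    simp [IncidenceAlgebra.apply_eq_zero_of_not_le h]⟩
  map_zero' := by ext I J _; simp
  map_one' := by
    ext I J _
    change (if J.1 \ I.1 ⊆ A then (1 : IncidenceAlgebra K (Idl H)) I J else 0) = _
    rw [IncidenceAlgebra.one_apply]
    split_ifs with h1 h2 h2
    · rfl
    · rfl
    · subst h2
      simp at h1
    · rfl
  map_add' a b := by
    ext I J _
    change (if J.1 \ I.1 ⊆ A then (a + b) I J else 0) =
      (if J.1 \ I.1 ⊆ A then a I J else 0) + (if J.1 \ I.1 ⊆ A then b I J else 0)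
    split_ifs <;> simp
  map_mul' a b := by
    ext I J hIJ
    change (if J.1 \ I.1 ⊆ A then (a * b) I J else 0) = _
    rw [IncidenceAlgebra.mul_apply, IncidenceAlgebra.mul_apply]
    change _ = ∑ M ∈ Finset.Icc I J, (if M.1 \ I.1 ⊆ A then a I M else 0) *
      (if J.1 \ M.1 ⊆ A then b M J else 0)
    -- `J \ I` is the disjoint union of `M \ I` and `J \ M`, so it lies in `A` exactly when both do.
    split_ifs with h
    · refine Finset.sum_congr rfl fun M hM => ?_
      obtain ⟨h1, h2⟩ := Finset.mem_Icc.1 hM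
      have hM1 : M.1 \ I.1 ⊆ A := fun v hv => h ⟨h2 hv.1, hv.2⟩
      have hM2 : J.1 \ M.1 ⊆ A := fun v hv => h ⟨hv.1, fun hI => hv.2 (h1 hI)⟩
      rw [if_pos hM1, if_pos hM2]
    · refine (Finset.sum_eq_zero fun M _ => ?_).symm
      split_ifs with h1 h2
      · refine absurd (fun v hv => ?_) h
        by_cases hM : v ∈ M.1
        · exact h1 ⟨hM, hv.2⟩
        · exact h2 ⟨hv.1, hM⟩
      · rw [mul_zero]
      · rw [zero_mul]
      · rw [zero_mul]

theorem mask_apply_of_subset [Finite V] {H : LForest V} {A : Set V}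
    (a : IncidenceAlgebra K (Idl H)) {I J : Idl H} (h : J.1 \ I.1 ⊆ A) :
    mask H A a I J = a I J := if_pos h

theorem mask_apply_of_not_subset [Finite V] {H : LForest V} {A : Set V}
    (a : IncidenceAlgebra K (Idl H)) {I J : Idl H} (h : ¬ J.1 \ I.1 ⊆ A) :
    mask H A a I J = 0 := if_neg h

/-- If `D` meets a set that is closed under parents, then some root of the forest induced on `D`
lies in that set. -/
theorem LForest.exists_root_restrict_mem {H : LForest V} {A D : Set V} (hA : H.IsLower A)
    (h : (D ∩ A).Nonempty) : ∃ r : D, (r : V) ∈ A ∧ (H.restrict D).parent r = none := by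
  obtain ⟨v, hv, hmin⟩ := H.wf.has_min _ h
  refine ⟨⟨v, hv.1⟩, hv.2, restrict_parent_eq_none.2 fun u hu hD => ?_⟩
  exact hmin u ⟨hD, hA hu hv.2⟩ hu

/-- Otherwise the forest on `D` would have a root on each side. -/
theorem LForest.subset_or_subset_compl_of_isTree {H : LForest V} {A D : Set V} (hA : H.IsLower A)
    (hA' : H.IsLower Aᶜ) (h : (H.restrict D).IsTree) : D ⊆ A ∨ D ⊆ Aᶜ := by
  by_contra hcon
  rw [not_or, Set.not_subset, Set.not_subset] at hcon
  obtain ⟨⟨v, hv, hvA⟩, w, hw, hwA⟩ := hcon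
  obtain ⟨r, hr, hr'⟩ := exists_root_restrict_mem (D := D) hA ⟨w, hw, not_not.1 hwA⟩
  obtain ⟨s, hs, hs'⟩ := exists_root_restrict_mem (D := D) hA' ⟨v, hv, hvA⟩
  rw [h.unique hr' hs'] at hr
  exact hs hr

/-- `incl B` is supported on trees, and a tree lies on one side only: series of trees are primitive.
-/
theorem mask_add_mask_compl [Finite V] {H : LForest V} {A : Set V} (hA : H.IsLower A)
    (hA' : H.IsLower Aᶜ) (B : PLHat K) :
    mask H A (incid H (incl B)) + mask H Aᶜ (incid H (incl B)) = incid H (incl B) := by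
  ext I J hIJ
  rw [IncidenceAlgebra.add_apply]
  by_cases ht : (H.restrict (J.1 \ I.1)).IsTree
  · obtain ⟨v, -⟩ := ht.exists
    rcases subset_or_subset_compl_of_isTree hA hA' ht with h | h
    · rw [mask_apply_of_subset _ h,
        mask_apply_of_not_subset _ fun h' : _ ⊆ Aᶜ => h' v.2 (h v.2), add_zero]
    · rw [mask_apply_of_subset _ h,
        mask_apply_of_not_subset _ fun h' : _ ⊆ A => h v.2 (h' v.2), zero_add]
  · have h0 : incid H (incl B) I J = 0 := by
      rw [incid_apply _ hIJ, val_incl_of_not_isTree _ ht]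
    have h1 : ∀ C : Set V, mask H C (incid H (incl B)) I J = 0 := fun C => by
      by_cases h : J.1 \ I.1 ⊆ C
      · rw [mask_apply_of_subset _ h, h0]
      · rw [mask_apply_of_not_subset _ h]
    rw [h1, h1, h0, add_zero]

/-- A nonzero term has `M \ I` in `A` and `J \ M` in `B`. The vertices of `J \ M` have no parent in
`M \ I`, so the two pieces can be added to `I` in the other order, through `I ∪ (J \ M)`. -/
theorem mask_mul_mask_apply_eq [Finite V] {H : LForest V} {A B : Set V}
    (hB : H.IsLower B) (hAB : Disjoint A B) (f : UHat K) {I J : Idl H} :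
    ∀ M ∈ Finset.Icc I J, mask H A (incid H f) I M * mask H B (incid H f) M J ≠ 0 →
      ∃ M' ∈ Finset.Icc I J, M'.1 = I.1 ∪ (J.1 \ M.1) ∧
        mask H A (incid H f) I M * mask H B (incid H f) M J =
          mask H B (incid H f) I M' * mask H A (incid H f) M' J := by
  intro M hM hne
  obtain ⟨h1, h2⟩ := Finset.mem_Icc.1 hM
  have h1' : I.1 ⊆ M.1 := h1
  have h2' : M.1 ⊆ J.1 := h2
  have hMA : M.1 \ I.1 ⊆ A := by
    by_contra h
    rw [mask_apply_of_not_subset _ h, zero_mul] at hne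
    exact hne rfl
  have hMB : J.1 \ M.1 ⊆ B := by
    by_contra h
    rw [mask_apply_of_not_subset (I := M) _ h, mul_zero] at hne
    exact hne rfl
  have hlow : H.IsLower (I.1 ∪ (J.1 \ M.1)) := by
    rintro v u h (hv | hv)
    · exact Or.inl (I.2 h hv)
    · by_cases huI : u ∈ I.1
      · exact Or.inl huI
      · exact Or.inr ⟨J.2 h hv.1, fun huM =>
          hAB.notMem_of_mem_left (hMA ⟨huM, huI⟩) (hB h (hMB hv))⟩
  have e1 : (I.1 ∪ (J.1 \ M.1)) \ I.1 = J.1 \ M.1 := by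
    ext v
    have := @h1' v
    simp only [Set.mem_sdiff, Set.mem_union]
    tauto
  have e2 : J.1 \ (I.1 ∪ (J.1 \ M.1)) = M.1 \ I.1 := by
    ext v
    have := @h2' v
    simp only [Set.mem_sdiff, Set.mem_union]
    tauto
  have l1 : I ≤ (⟨I.1 ∪ (J.1 \ M.1), hlow⟩ : Idl H) := Set.subset_union_left
  have l2 : (⟨I.1 ∪ (J.1 \ M.1), hlow⟩ : Idl H) ≤ J :=
    Set.union_subset (h1'.trans h2') Set.sdiff_subset
  refine ⟨⟨I.1 ∪ (J.1 \ M.1), hlow⟩, Finset.mem_Icc.2 ⟨l1, l2⟩, rfl, ?_⟩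
  rw [mask_apply_of_subset _ hMA, mask_apply_of_subset (I := M) _ hMB,
    mask_apply_of_subset (I := I) _ (e1.subset.trans hMB),
    mask_apply_of_subset (J := J) _ (e2.subset.trans hMA), incid_apply _ h1, incid_apply _ h2,
    incid_apply _ l1, incid_apply _ l2, mul_comm]
  exact congrArg₂ (· * ·) (val_restrict_congr f H e1.symm) (val_restrict_congr f H e2.symm)

/-- Exchanging the order of the two pieces is a bijection between the nonzero terms of the two
products. -/
theorem mask_commute_mask [Finite V] {H : LForest V} {A B : Set V} (hA : H.IsLower A)
    (hB : H.IsLower B) (hAB : Disjoint A B) (f : UHat K) :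
    Commute (mask H A (incid H f)) (mask H B (incid H f)) := by
  refine IncidenceAlgebra.ext fun I J _ => ?_
  rw [IncidenceAlgebra.mul_apply, IncidenceAlgebra.mul_apply]
  choose! φ hφ hφ' hval using mask_mul_mask_apply_eq hB hAB f (I := I) (J := J)
  have inj : ∀ M ∈ Finset.Icc I J, ∀ N ∈ Finset.Icc I J,
      I.1 ∪ (J.1 \ M.1) = I.1 ∪ (J.1 \ N.1) → M = N := by
    intro M hM N hN h
    obtain ⟨h1, h2⟩ := Finset.mem_Icc.1 hM
    obtain ⟨h3, h4⟩ := Finset.mem_Icc.1 hN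
    refine Idl.carrier_injective _ (Set.ext fun v => ?_)
    have h1' := @h1 v
    have h2' := @h2 v
    have h3' := @h3 v
    have h4' := @h4 v
    have hv := congrArg (v ∈ ·) h
    simp only [Set.mem_sdiff, Set.mem_union, eq_iff_iff] at hv
    tauto
  refine Finset.sum_bij_ne_zero (fun M _ _ => φ M) (fun M hM h => hφ M hM h) ?_ ?_
    (fun M hM h => hval M hM h)
  · intro M hM h N hN h' heq
    refine inj M hM N hN ?_
    rw [← hφ' M hM h, ← hφ' N hN h', heq]
  · intro N hN h
    obtain ⟨M, hM, hMN, hv⟩ := mask_mul_mask_apply_eq hA hAB.symm f N hN h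
    rw [hv] at h
    refine ⟨M, hM, h, inj _ (hφ M hM h) N hN ?_⟩
    obtain ⟨h1, h2⟩ := Finset.mem_Icc.1 hN
    rw [hφ' M hM h, hMN]
    ext v
    have h1' := @h1 v
    have h2' := @h2 v
    simp only [Set.mem_sdiff, Set.mem_union]
    tauto

theorem isNilpotent_incid_incl [Finite V] (H : LForest V) (A : PLHat K) :
    IsNilpotent (incid H (incl A)) := ⟨_, incid_incl_pow_eq_zero H A⟩

theorem incid_expU [Finite V] (H : LForest V) (A : PLHat ℚ) :
    incid H (expU A) = IsNilpotent.exp (incid H (incl A)) := by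
  rw [expU, incid_powerSeriesAt, aeval_trunc_eq_sum,
    IsNilpotent.exp_eq_sum (incid_incl_pow_eq_zero H A)]
  refine Finset.sum_congr rfl fun k _ => ?_
  rw [PowerSeries.coeff_exp, Algebra.algebraMap_self_apply, one_div]

/-- The exponential of a series of trees is multiplicative for disjoint unions of forests. -/
theorem val_expU_eq_mul [Finite V] {H : LForest V} {A : Set V} (hA : H.IsLower A)
    (hA' : H.IsLower Aᶜ) (B : PLHat ℚ) :
    val (expU B) H = val (expU B) (H.restrict A) * val (expU B) (H.restrict Aᶜ) := by
  have hnil := isNilpotent_incid_incl H B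
  -- Ring homomorphisms preserve the exponential, and the exponential of a sum of commuting
  -- nilpotents is a product.
  have h : incid H (expU B) = mask H A (incid H (expU B)) * mask H Aᶜ (incid H (expU B)) := by
    rw [incid_expU, IsNilpotent.map_exp hnil, IsNilpotent.map_exp hnil,
      ← IsNilpotent.exp_add_of_commute (mask_commute_mask hA hA' disjoint_compl_right _)
        (hnil.map _) (hnil.map _), mask_add_mask_compl hA hA']
  -- A contributing `M` satisfies `M ⊆ A` and `Mᶜ ⊆ Aᶜ`, hence equals `A`.
  rw [← incid_bot_top, h, IncidenceAlgebra.mul_apply,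
    Finset.sum_eq_single (⟨A, hA⟩ : Idl H), mask_apply_of_subset, mask_apply_of_subset,
    incid_bot, incid_top]
  · exact fun v hv => hv.2
  · exact Set.sdiff_subset
  · intro M _ hM
    by_cases h1 : M.1 ⊆ A
    · rw [mask_apply_of_not_subset (I := M), mul_zero]
      intro h2
      refine hM (Idl.carrier_injective _ (h1.antisymm fun v hv => ?_))
      by_contra hvM
      exact h2 ⟨trivial, hvM⟩ hv
    · rw [mask_apply_of_not_subset, zero_mul]
      intro h2
      exact h1 fun v hv => h2 ⟨hv, id⟩
  · intro h
    exact absurd (Finset.mem_Icc.2 ⟨bot_le, le_top⟩) h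

/-! ### Edgeless forests and the values of exp Ω -/

/-- A forest is edgeless if every vertex is a root. -/
def LForest.Edgeless (H : LForest V) : Prop := ∀ v, H.parent v = none

theorem LForest.IsTree.edgeless_iff [Finite V] {H : LForest V} (h : H.IsTree) :
    H.Edgeless ↔ Nat.card V = 1 := by
  obtain ⟨r, hr⟩ := h.exists
  rw [Nat.card_eq_one_iff_unique]
  constructor
  · intro he
    exact ⟨⟨fun v w => h.unique (he v) (he w)⟩, ⟨r⟩⟩
  · rintro ⟨hs, -⟩ v
    rw [Subsingleton.elim v r, hr]

theorem LForest.edgeless_iff_restrict {H : LForest V} {A : Set V} (hA : H.IsLower A)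
    (hA' : H.IsLower Aᶜ) :
    H.Edgeless ↔ (H.restrict A).Edgeless ∧ (H.restrict Aᶜ).Edgeless := by
  constructor
  · intro h
    constructor <;> intro v <;> refine restrict_parent_eq_none.2 fun u hu => ?_ <;> rw [h] at hu <;>
      cases hu
  · rintro ⟨h1, h2⟩ v
    refine Option.eq_none_iff_forall_ne_some.2 fun u hu => ?_
    by_cases hv : v ∈ A
    · exact restrict_parent_eq_none.1 (h1 ⟨v, hv⟩) u hu (hA hu hv)
    · exact restrict_parent_eq_none.1 (h2 ⟨v, hv⟩) u hu (hA' hu hv)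

/-- The connected component of a root of a forest that is not a tree. -/
theorem LForest.exists_isLower_of_not_isTree [Nonempty V] {H : LForest V} (h : ¬ H.IsTree) :
    ∃ A : Set V, A.Nonempty ∧ Aᶜ.Nonempty ∧ H.IsLower A ∧ H.IsLower Aᶜ := by
  obtain ⟨r, hr⟩ := H.exists_root
  let R : V → V → Prop := fun v u => H.parent v = some u
  have root : ∀ v, H.parent v = none → Relation.ReflTransGen R v r → v = r := by
    intro v hv hvr
    rcases hvr.cases_head with h | ⟨u, hu, -⟩
    · exact h
    · have hu : H.parent v = some u := hu
      rw [hv] at hu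
      cases hu
  refine ⟨{v | Relation.ReflTransGen R v r}, ⟨r, Relation.ReflTransGen.refl⟩, ?_, ?_, ?_⟩
  · by_contra hne
    rw [Set.not_nonempty_iff_eq_empty, Set.compl_empty_iff] at hne
    exact h ⟨r, hr, fun v hv => root v hv (hne.symm.subset (Set.mem_univ v))⟩
  · intro v u hvu hv
    rcases Relation.ReflTransGen.cases_head hv with rfl | ⟨w, hw, hwr⟩
    · rw [hr] at hvu
      cases hvu
    · have hw : H.parent v = some w := hw
      rw [hw] at hvu
      obtain rfl := Option.some.inj hvu
      exact hwr
  · intro v u hvu hv hu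
    exact hv (Relation.ReflTransGen.head (show R v u from hvu) hu)

theorem val_expU_of_isEmpty [Finite V] [IsEmpty V] (A : PLHat ℚ) (H : LForest V) :
    val (expU A) H = 1 := by
  rw [expU, val_powerSeriesAt, Nat.card_of_isEmpty, zero_add, Finset.sum_range_one, starPow,
    val_oneU_of_isEmpty]
  simp

open Classical in
/-- The exponential of `Ω` is the sum of the forests without edges, weighted by their
automorphisms. -/
theorem IsOmega.val_expU {Ω : PLHat ℚ} (hΩ : IsOmega Ω) :
    ∀ (n : ℕ) {V : Type} [Finite V] (H : LForest V), Nat.card V = n →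
      val (expU Ω) H = if H.Edgeless then 1 else 0 := by
  intro n
  induction n using Nat.strong_induction_on with
  | _ n ih =>
    intro V _ H hn
    rcases isEmpty_or_nonempty V with hV | hV
    · have he : H.Edgeless := fun v => isEmptyElim v
      rw [val_expU_of_isEmpty, if_pos he]
    · by_cases ht : H.IsTree
      · rw [hΩ.val_expU_of_isTree ht]
        simp only [ht.edgeless_iff]
      · obtain ⟨A, hne, hne', hA, hA'⟩ := exists_isLower_of_not_isTree ht
        have hlt : ∀ B : Set V, Bᶜ.Nonempty → Nat.card B < n := by
          rintro B ⟨v, hv⟩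
          rw [← hn]
          exact Set.ncard_lt_card fun h => hv (h ▸ Set.mem_univ v)
        rw [val_expU_eq_mul hA hA', ih _ (hlt A hne') _ rfl,
          ih _ (hlt Aᶜ (by rwa [compl_compl])) _ rfl]
        simp only [edgeless_iff_restrict hA hA']
        split_ifs <;> simp_all

/-! ### The alternating sum over the lower sets with edgeless complement -/

/-- A leaf of a nonempty forest. -/
theorem LForest.exists_leaf [Finite V] [Nonempty V] (H : LForest V) :
    ∃ l, ∀ v, H.parent v ≠ some l := by
  let R : V → V → Prop := Relation.TransGen fun u v => H.parent v = some u
  have hwf : WellFounded R := H.wf.transGen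
  have : Std.Irrefl (Function.swap R) := ⟨fun v h => hwf.irrefl.irrefl v h⟩
  have : IsTrans V (Function.swap R) := ⟨fun _ _ _ h h' => Relation.TransGen.trans h' h⟩
  -- By finiteness the descendant order is well founded in the other direction too; a minimal
  -- element there is a leaf.
  have hwf' : WellFounded (Function.swap R) := Finite.wellFounded_of_trans_of_irrefl _
  obtain ⟨l, -, hl⟩ := hwf'.has_min Set.univ Set.univ_nonempty
  exact ⟨l, fun v hv => hl v trivial (Relation.TransGen.single hv)⟩

theorem LForest.edgeless_restrict_compl_iff {H : LForest V} {D : Set V} :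
    (H.restrict Dᶜ).Edgeless ↔ ∀ v u, v ∉ D → H.parent v = some u → u ∈ D := by
  constructor
  · intro h v u hv hu
    exact not_not.1 (restrict_parent_eq_none.1 (h ⟨v, hv⟩) u hu)
  · intro h v
    exact restrict_parent_eq_none.2 fun u hu => not_not.2 (h v u v.2 hu)

/-- The two conditions on `D` together say that every parent lies in `D`. As `l` is nobody's parent,
its membership is free. -/
theorem LForest.isLower_symmDiff_leaf {H : LForest V} {l : V} (hl : ∀ v, H.parent v ≠ some l)
    {D : Set V} (hD : H.IsLower D) (he : (H.restrict Dᶜ).Edgeless) :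
    H.IsLower (symmDiff D {l}) ∧ (H.restrict (symmDiff D {l})ᶜ).Edgeless := by
  rw [edgeless_restrict_compl_iff] at he ⊢
  have hne : ∀ {v u}, H.parent v = some u → u ≠ l := by
    rintro v u h rfl
    exact hl v h
  refine ⟨?_, ?_⟩
  · rintro v u h hv
    refine Or.inl ⟨?_, hne h⟩
    by_cases hvD : v ∈ D
    · exact hD h hvD
    · exact he v u hvD h
  · intro v u hv h
    refine Or.inl ⟨?_, hne h⟩
    by_cases hvD : v ∈ D
    · exact hD h hvD
    · exact he v u hvD h

theorem neg_one_pow_ncard_symmDiff [Finite V] (D : Set V) (l : V) :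
    (-1 : ℚ) ^ (symmDiff D {l}).ncard = -(-1) ^ D.ncard := by
  by_cases h : l ∈ D
  · have hs : symmDiff D {l} = D \ {l} := by
      ext v
      simp only [Set.mem_symmDiff, Set.mem_singleton_iff, Set.mem_sdiff]
      constructor
      · rintro (h' | ⟨rfl, h'⟩)
        · exact h'
        · exact absurd h h'
      · exact Or.inl
    rw [hs, ← Set.ncard_sdiff_singleton_add_one h, pow_succ]
    ring
  · have hs : symmDiff D {l} = insert l D := by
      ext v
      simp only [Set.mem_symmDiff, Set.mem_singleton_iff, Set.mem_insert_iff]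
      constructor
      · rintro (h' | h')
        · exact Or.inr h'.1
        · exact Or.inl h'.1
      · rintro (rfl | h')
        · exact Or.inr ⟨rfl, h⟩
        · exact Or.inl ⟨h', fun hv => h (hv ▸ h')⟩
    rw [hs, Set.ncard_insert_of_notMem h, pow_succ]
    ring

-- Toggling a leaf pairs off the terms with opposite signs.
open Classical in
theorem sum_idl_alternating [Finite V] [Nonempty V] (H : LForest V) :
    ∑ D : Idl H, (-1 : ℚ) ^ D.1.ncard * (if (H.restrict D.1ᶜ).Edgeless then 1 else 0) = 0 := by
  obtain ⟨l, hl⟩ := H.exists_leaf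
  simp only [mul_ite, mul_one, mul_zero]
  rw [← Finset.sum_filter]
  refine Finset.sum_involution
    (fun D hD => ⟨symmDiff D.1 {l},
      (isLower_symmDiff_leaf hl D.2 (Finset.mem_filter.1 hD).2).1⟩) ?_ ?_ ?_ ?_
  · intro D hD
    rw [neg_one_pow_ncard_symmDiff, add_neg_cancel]
  · intro D hD _ h
    have h' : symmDiff D.1 {l} = D.1 := congrArg Idl.carrier h
    rw [symmDiff_eq_left] at h'
    exact Set.singleton_ne_empty l h'
  · intro D hD
    exact Finset.mem_filter.2
      ⟨Finset.mem_univ _, (isLower_symmDiff_leaf hl D.2 (Finset.mem_filter.1 hD).2).2⟩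
  · intro D hD
    exact Idl.carrier_injective _ (symmDiff_symmDiff_cancel_right _ _)

/-! ### The exponential of `-Ω` -/

theorem uHat_ext [CharZero K] {f g : UHat K}
    (h : ∀ (n : ℕ) (H : LForest (Fin n)), val f H = val g H) : f = g := by
  funext n F
  have := h n F.rep
  rw [val_rep, val_rep] at this
  exact mul_left_cancel₀ F.rep.card_auto_ne_zero this

/-- The entry from ⊥ to ⊤ recovers the weighted coefficient, so ⋆ inherits the ring laws of
incidence algebras. -/
theorem uHat_ext_incid [CharZero K] {f g : UHat K}
    (h : ∀ (n : ℕ) (H : LForest (Fin n)), incid H f = incid H g) : f = g :=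
  uHat_ext fun n H => by rw [← incid_bot_top, h, incid_bot_top]

theorem oneU_starMul [CharZero K] (f : UHat K) : starMul oneU f = f :=
  uHat_ext_incid fun n H => by rw [incid_starMul, incid_oneU, one_mul]

theorem starMul_oneU [CharZero K] (f : UHat K) : starMul f oneU = f :=
  uHat_ext_incid fun n H => by rw [incid_starMul, incid_oneU, mul_one]

theorem sub_starMul (f g h : UHat K) : starMul (f - g) h = starMul f h - starMul g h := by
  funext n H
  simp only [starMul, Pi.sub_apply, sub_mul, Finset.sum_sub_distrib]

theorem incid_incl_neg [Finite V] (H : LForest V) (A : PLHat K) :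
    incid H (incl (-A)) = -incid H (incl A) := by
  have hA : incl (-A) = -incl A := by
    funext n F
    change incl (-A) n F = -incl A n F
    by_cases h : F.rep.IsTree
    · rw [incl, incl, dif_pos h, dif_pos h]
      rfl
    · rw [incl, incl, dif_neg h, dif_neg h, neg_zero]
  rw [hA]
  refine IncidenceAlgebra.ext fun I J hIJ => ?_
  rw [IncidenceAlgebra.neg_apply, incid_apply _ hIJ, incid_apply _ hIJ, val, val, Pi.neg_apply,
    Pi.neg_apply, mul_neg]

theorem expU_starMul_expU_neg (A : PLHat ℚ) : starMul (expU A) (expU (-A)) = oneU :=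
  uHat_ext_incid fun n H => by
    rw [incid_starMul, incid_expU, incid_expU, incid_incl_neg, incid_oneU]
    exact IsNilpotent.exp_mul_exp_neg_self (isNilpotent_incid_incl H A)

/-- The sum of all forests, weighted by signs and automorphisms. -/
def altU : UHat ℚ := fun n F => (-1) ^ n / (Nat.card (Iso F.rep F.rep) : ℚ)

theorem val_altU [Finite V] (H : LForest V) : val altU H = (-1) ^ Nat.card V := by
  rw [val, altU, ← H.iso_toForest_rep.some.card_auto,
    mul_div_cancel₀ _ H.card_auto_ne_zero]

theorem IsOmega.altU_starMul_expU {Ω : PLHat ℚ} (hΩ : IsOmega Ω) :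
    starMul altU (expU Ω) = oneU := by
  classical
  refine uHat_ext fun n H => ?_
  rw [val_starMul]
  simp only [val_altU, hΩ.val_expU _ _ rfl]
  rcases isEmpty_or_nonempty (Fin n) with h | h
  · have he : (H.restrict (⊥ : Idl H).1ᶜ).Edgeless := fun v => isEmptyElim v.1
    rw [val_oneU_of_isEmpty, Fintype.sum_eq_single (⊥ : Idl H), if_pos he, Idl.bot_carrier]
    · simp
    · intro D hD
      exact absurd (Idl.carrier_injective _ (Subsingleton.elim _ _)) hD
  · rw [val_oneU_of_nonempty]
    exact sum_idl_alternating H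

theorem IsOmega.expU_neg {Ω : PLHat ℚ} (hΩ : IsOmega Ω) : expU (-Ω) = altU :=
  uHat_ext_incid fun n H => by
    have h1 := congrArg (incid H) hΩ.altU_starMul_expU
    have h2 := congrArg (incid H) (expU_starMul_expU_neg Ω)
    rw [incid_starMul, incid_oneU] at h1 h2
    -- The alternating sum is a left inverse of exp Ω and exp(-Ω) a right inverse.
    exact (left_inv_eq_right_inv h1 h2).symm

/-! ### The signed sum of trees and the equations it satisfies -/

/-- The sum of all trees, weighted by signs and automorphisms. -/
def altTrees : PLHat ℚ := fun n T => (-1) ^ (n - 1) / (aut T : ℚ)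

/-- The unit does not affect trees; it cancels the empty forest, as `act_treePart` requires. -/
theorem altTrees_eq_treePart : altTrees = treePart (oneU - altU) := by
  funext n T
  have hn : n ≠ 0 := by
    rintro rfl
    exact isEmptyElim T
  obtain ⟨m, rfl⟩ := Nat.exists_eq_succ_of_ne_zero hn
  change (-1 : ℚ) ^ (m + 1 - 1) / (aut T : ℚ) =
    (if m + 1 = 0 then 1 else 0) - (-1) ^ (m + 1) / (aut T : ℚ)
  rw [if_neg (Nat.succ_ne_zero m), Nat.add_sub_cancel, pow_succ]
  ring

theorem oneU_sub_altU_zero (F : Forest 0) : (oneU - altU : UHat ℚ) 0 F = 0 := by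
  have h : ∀ f : UHat ℚ, f 0 F = val f F.rep := fun f => by
    have : Subsingleton (Iso F.rep F.rep) :=
      ⟨fun e f => Subtype.ext (Equiv.ext fun v => isEmptyElim v)⟩
    have := Iso.refl F.rep
    rw [val_rep, Nat.card_unique, Nat.cast_one, one_mul]
  rw [Pi.sub_apply, Pi.sub_apply, h oneU, h altU, val_altU, val_oneU_of_isEmpty]
  simp

theorem expU_sub_oneU_zero [Algebra ℚ K] (A : PLHat K) (F : Forest 0) :
    (expU A - oneU : UHat K) 0 F = 0 := by
  simp [expU, powerSeriesAt, starPow]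

theorem IsOmega.treePart_expU_sub_oneU {Ω : PLHat ℚ} (hΩ : IsOmega Ω) :
    treePart (expU Ω - oneU) = dot := by
  refine pLHat_ext fun n H h => ?_
  have : Nonempty (Fin n) := ⟨h.exists.choose⟩
  have hsub : val (expU Ω - oneU) H = val (expU Ω) H - val oneU H := by
    rw [val, val, val, Pi.sub_apply, Pi.sub_apply, mul_sub]
  rw [val_incl_treePart _ h, hsub, hΩ.val_expU_of_isTree h, val_oneU_of_nonempty, sub_zero,
    val_incl_dot h]

/-- With • replaced by exp Ω - 1, this is (exp Ω - 1) ⋆ exp(-Ω) = 1 - exp(-Ω). -/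
theorem IsOmega.act_dot_expU_neg {Ω : PLHat ℚ} (hΩ : IsOmega Ω) :
    act dot (expU (-Ω)) = altTrees := by
  rw [← hΩ.treePart_expU_sub_oneU, act_treePart (expU_sub_oneU_zero Ω), sub_starMul,
    expU_starMul_expU_neg, oneU_starMul, hΩ.expU_neg, altTrees_eq_treePart]

theorem act_sub (A : PLHat K) (f g : UHat K) : act A (f - g) = act A f - act A g := by
  funext n S
  simp only [act, Pi.sub_apply, mul_sub, sub_mul, Finset.sum_sub_distrib]

theorem act_oneU [CharZero K] (A : PLHat K) : act A oneU = A := by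
  rw [act_eq_treePart, starMul_oneU, treePart_incl]

/-- The tree part of (1 - exp(-Ω)) ⋆ exp Ω = exp Ω - 1; this is the equation of Ω_q in the limit. -/
theorem IsOmega.altTrees_add_act {Ω : PLHat ℚ} (hΩ : IsOmega Ω) :
    altTrees + act altTrees (expU Ω - oneU) = dot := by
  have h : act altTrees (expU Ω) = dot := by
    rw [altTrees_eq_treePart, act_treePart oneU_sub_altU_zero, sub_starMul, oneU_starMul,
      hΩ.altU_starMul_expU, hΩ.treePart_expU_sub_oneU]
  rw [act_sub, act_oneU, h]
  abel

/-! ### Solving triangular equations -/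

/-- A map for which the component of degree `n` of the image depends only on the components of
degree less than `n` has a unique fixed point. -/
theorem existsUnique_fixedPoint {β : ℕ → Type} [∀ n, Inhabited (β n)]
    (Φ : (∀ n, β n) → ∀ n, β n)
    (h : ∀ (n : ℕ) (A B : ∀ n, β n), (∀ m < n, A m = B m) → Φ A n = Φ B n) : ∃! A, Φ A = A := by
  -- The component of degree `m` of the iterates is constant from step `m + 1` on, whatever the
  -- starting point.
  let u : ℕ → ∀ n, β n := fun k => Φ^[k] fun _ => default
  have hu : ∀ k, u (k + 1) = Φ (u k) := fun k => Function.iterate_succ_apply' Φ k _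
  have hstep : ∀ k, ∀ m < k, u (k + 1) m = u k m := by
    intro k
    induction k with
    | zero => exact fun m hm => absurd hm (Nat.not_lt_zero m)
    | succ k ih =>
      intro m hm
      rw [hu (k + 1), hu k]
      refine h m _ _ fun l hl => ?_
      rw [← hu k]
      exact ih l (by omega)
  have hstab : ∀ m k, u (m + 1 + k) m = u (m + 1) m := by
    intro m k
    induction k with
    | zero => rfl
    | succ k ih => rw [← ih, ← add_assoc, hstep _ m (by omega)]
  refine ⟨fun m => u (m + 1) m, ?_, ?_⟩
  · funext n
    rw [hu]
    refine h n _ _ fun m hm => ?_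
    obtain ⟨k, rfl⟩ := Nat.exists_eq_add_of_lt hm
    rw [show m + k + 1 = m + 1 + k by omega, hstab]
  · intro B hB
    have key : ∀ n, B n = u (n + 1) n := by
      intro n
      induction n using Nat.strong_induction_on with
      | _ n ih =>
        rw [← hB, hu]
        refine h n _ _ fun m hm => ?_
        obtain ⟨k, rfl⟩ := Nat.exists_eq_add_of_lt hm
        rw [ih m hm, show m + k + 1 = m + 1 + k by omega, hstab]
    exact funext key

theorem incl_congr {A B : PLHat K} {n : ℕ} (h : A n = B n) : incl A n = incl B n := by
  funext F
  simp only [incl, h]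

theorem starMul_congr {f f' g g' : UHat K} {n : ℕ} (hf : ∀ m ≤ n, f m = f' m)
    (hg : ∀ m ≤ n, g m = g' m) : starMul f g n = starMul f' g' n := by
  funext H
  refine Finset.sum_congr rfl fun p hp => ?_
  have := Finset.HasAntidiagonal.mem_antidiagonal.1 hp
  rw [hf p.1 (by omega), hg p.2 (by omega)]

theorem powerSeriesAt_congr (φ : PowerSeries K) {A B : PLHat K} {n : ℕ}
    (h : ∀ m ≤ n, A m = B m) : powerSeriesAt φ A n = powerSeriesAt φ B n := by
  have hpow : ∀ k, ∀ m ≤ n, starPow (incl A) k m = starPow (incl B) k m := by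
    intro k
    induction k with
    | zero => exact fun _ _ => rfl
    | succ k ih =>
      exact fun m hm => starMul_congr (fun l hl => ih l (hl.trans hm))
        fun l hl => incl_congr (h l (hl.trans hm))
  funext F
  exact Finset.sum_congr rfl fun k _ => by rw [hpow k n le_rfl]

/-- A tree has at least one vertex, which leaves fewer than `n` for the acting forest. -/
theorem act_congr_right (A : PLHat K) {f g : UHat K} {n : ℕ} (h : ∀ m < n, f m = g m) :
    act A f n = act A g n := by
  funext S
  refine Finset.sum_congr rfl fun p hp => Finset.sum_congr rfl fun T _ => ?_
  have := Finset.HasAntidiagonal.mem_antidiagonal.1 hp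
  obtain ⟨i, j⟩ := p
  rcases i with _ | i
  · exact isEmptyElim T
  · have hj : j < n := by
      simp only at this
      omega
    rw [h j hj]

theorem act_congr_left {A B : PLHat K} {f : UHat K} (hf : ∀ F, f 0 F = 0) {n : ℕ}
    (h : ∀ m < n, A m = B m) : act A f n = act B f n := by
  funext S
  refine Finset.sum_congr rfl fun p hp => Finset.sum_congr rfl fun T _ =>
    Finset.sum_congr rfl fun G _ => ?_
  have := Finset.HasAntidiagonal.mem_antidiagonal.1 hp
  obtain ⟨i, j⟩ := p
  rcases j with _ | j
  · rw [hf, mul_zero, mul_zero]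
  · have hi : i < n := by
      simp only at this
      omega
    rw [h i hi]

theorem existsUnique_isOmega : ∃! Ω : PLHat ℚ, IsOmega Ω :=
  existsUnique_fixedPoint (fun A => act dot (bernoulliU A)) fun _ _ _ h =>
    act_congr_right _ fun _ hm => powerSeriesAt_congr _ fun l hl => h l (hl.trans_lt hm)

theorem ratFunc_X_pow_sub_one_ne_zero {n : ℕ} (hn : n ≠ 0) :
    (RatFunc.X : RatFunc ℚ) ^ n - 1 ≠ 0 := by
  rw [← RatFunc.algebraMap_X, ← map_pow, ← map_one (algebraMap (Polynomial ℚ) (RatFunc ℚ)),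
    ← map_sub]
  refine RatFunc.algebraMap_ne_zero ?_
  exact Polynomial.X_pow_sub_C_ne_zero (Nat.pos_of_ne_zero hn) 1

/-- Fixed-point form: in degree `n` the linear part is multiplication by `q ^ n - 1`, invertible as
`n ≥ 1`, and the other terms only involve lower degrees. -/
theorem isOmegaQ_iff (Ω : PLHat ℚ) (A : PLHat (RatFunc ℚ)) : IsOmegaQ Ω A ↔
    (fun n T => ((RatFunc.X : RatFunc ℚ) ^ n - 1)⁻¹ *
      (preLie dot A n T + ((RatFunc.X : RatFunc ℚ) - 1) * dot n T -
        act (qShift RatFunc.X A) (expU (toRatFunc Ω) - oneU) n T)) = A := by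
  have key : ∀ n (T : RTree n), (act (qShift RatFunc.X A) (expU (toRatFunc Ω) - oneU) +
      qShift RatFunc.X A - A) n T =
      (preLie dot A + ((RatFunc.X : RatFunc ℚ) - 1) • dot : PLHat (RatFunc ℚ)) n T ↔
      ((RatFunc.X : RatFunc ℚ) ^ n - 1)⁻¹ *
      (preLie dot A n T + ((RatFunc.X : RatFunc ℚ) - 1) * dot n T -
        act (qShift RatFunc.X A) (expU (toRatFunc Ω) - oneU) n T) = A n T := by
    intro n T
    have hn : n ≠ 0 := by
      rintro rfl
      exact isEmptyElim T
    rw [inv_mul_eq_iff_eq_mul₀ (ratFunc_X_pow_sub_one_ne_zero hn)]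
    simp only [Pi.add_apply, Pi.sub_apply, Pi.smul_apply, smul_eq_mul]
    have hq : qShift RatFunc.X A n T = RatFunc.X ^ n * A n T := rfl
    rw [hq]
    constructor
    · intro h
      linear_combination -h
    · intro h
      linear_combination -h
  constructor
  · intro h
    funext n T
    exact (key n T).1 (congrFun (congrFun h n) T)
  · intro h
    funext n T
    exact (key n T).2 (congrFun (congrFun h n) T)

theorem existsUnique_isOmegaQ (Ω : PLHat ℚ) : ∃! Ωq : PLHat (RatFunc ℚ), IsOmegaQ Ω Ωq := by
  simp only [isOmegaQ_iff]
  refine existsUnique_fixedPoint _ fun n A B h => ?_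
  have h1 : preLie dot A n = preLie dot B n :=
    act_congr_right _ fun m hm => incl_congr (h m hm)
  have h2 : act (qShift RatFunc.X A) (expU (toRatFunc Ω) - oneU) n =
      act (qShift RatFunc.X B) (expU (toRatFunc Ω) - oneU) n :=
    act_congr_left (expU_sub_oneU_zero _) fun m hm => by
      funext T
      rw [qShift, qShift, h m hm]
  funext T
  rw [h1, h2]

/-! ### Limits of rational functions at infinity -/

/-- The rational function `x` has the limit `l` at infinity. -/
def HasLim (x : RatFunc ℚ) (l : ℚ) : Prop :=
  Tendsto (fun t : ℝ => RatFunc.eval (algebraMap ℚ ℝ) t x) atTop (𝓝 (l : ℝ))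

/-- Evaluation respects sums and products away from the zeros of the denominators, hence for all
large `t`. -/
theorem eventually_denom_ne_zero (x : RatFunc ℚ) :
    ∀ᶠ t : ℝ in atTop, Polynomial.eval₂ (algebraMap ℚ ℝ) t x.denom ≠ 0 := by
  have h : x.denom.map (algebraMap ℚ ℝ) ≠ 0 :=
    (Polynomial.map_ne_zero_iff (algebraMap ℚ ℝ).injective).2 x.denom_ne_zero
  filter_upwards [Polynomial.eventually_atTop_not_isRoot _ h] with t ht
  rwa [Polynomial.IsRoot, Polynomial.eval_map] at ht

theorem HasLim.add {x y : RatFunc ℚ} {l m : ℚ} (hx : HasLim x l) (hy : HasLim y m) :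
    HasLim (x + y) (l + m) := by
  have h := Tendsto.add hx hy
  rw [← Rat.cast_add] at h
  refine h.congr' ?_
  filter_upwards [eventually_denom_ne_zero x, eventually_denom_ne_zero y] with t h1 h2
  exact (RatFunc.eval_add _ _ h1 h2).symm

theorem HasLim.mul {x y : RatFunc ℚ} {l m : ℚ} (hx : HasLim x l) (hy : HasLim y m) :
    HasLim (x * y) (l * m) := by
  have h := Tendsto.mul hx hy
  rw [← Rat.cast_mul] at h
  refine h.congr' ?_
  filter_upwards [eventually_denom_ne_zero x, eventually_denom_ne_zero y] with t h1 h2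
  exact (RatFunc.eval_mul _ _ h1 h2).symm

theorem hasLim_const (c : ℚ) : HasLim (algebraMap ℚ (RatFunc ℚ) c) c := by
  have h : ∀ t : ℝ, RatFunc.eval (algebraMap ℚ ℝ) t (algebraMap ℚ (RatFunc ℚ) c) = (c : ℝ) := by
    intro t
    have hc : algebraMap ℚ (RatFunc ℚ) c = RatFunc.C c :=
      (eq_ratCast _ c).trans (eq_ratCast RatFunc.C c).symm
    rw [hc, RatFunc.eval_C]
    rfl
  simp only [HasLim, h]
  exact tendsto_const_nhds

theorem hasLim_zero : HasLim 0 0 := by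
  simpa using hasLim_const 0

theorem hasLim_one : HasLim 1 1 := by
  simpa using hasLim_const 1

theorem HasLim.sub {x y : RatFunc ℚ} {l m : ℚ} (hx : HasLim x l) (hy : HasLim y m) :
    HasLim (x - y) (l - m) := by
  have h := hx.add ((hasLim_const (-1)).mul hy)
  rw [map_neg, map_one, neg_one_mul, neg_one_mul, ← sub_eq_add_neg, ← sub_eq_add_neg] at h
  exact h

theorem HasLim.sum {ι : Type} (s : Finset ι) {x : ι → RatFunc ℚ} {l : ι → ℚ}
    (h : ∀ i ∈ s, HasLim (x i) (l i)) : HasLim (∑ i ∈ s, x i) (∑ i ∈ s, l i) := by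
  classical
  induction s using Finset.induction_on with
  | empty => simpa using hasLim_zero
  | insert i s hi ih =>
    rw [Finset.sum_insert hi, Finset.sum_insert hi]
    exact (h i (Finset.mem_insert_self i s)).add
      (ih fun j hj => h j (Finset.mem_insert_of_mem hj))

theorem eventually_eval_inv {x : RatFunc ℚ} (hx : x ≠ 0) : ∀ᶠ t : ℝ in atTop,
    RatFunc.eval (algebraMap ℚ ℝ) t x⁻¹ = (RatFunc.eval (algebraMap ℚ ℝ) t x)⁻¹ := by
  filter_upwards [eventually_denom_ne_zero x, eventually_denom_ne_zero x⁻¹] with t h1 h2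
  have h := RatFunc.eval_mul _ _ h1 h2
  rw [mul_inv_cancel₀ hx, RatFunc.eval_one] at h
  exact eq_inv_of_mul_eq_one_right h.symm

theorem HasLim.inv {x : RatFunc ℚ} {l : ℚ} (hx : HasLim x l) (hl : l ≠ 0) : HasLim x⁻¹ l⁻¹ := by
  have hx0 : x ≠ 0 := by
    rintro rfl
    have h := tendsto_nhds_unique hx hasLim_zero
    exact hl (by exact_mod_cast h)
  have h := Tendsto.inv₀ hx (Rat.cast_ne_zero.2 hl)
  rw [← Rat.cast_inv] at h
  refine h.congr' ?_
  filter_upwards [eventually_eval_inv hx0] with t ht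
  exact ht.symm

theorem hasLim_inv_X : HasLim (RatFunc.X)⁻¹ 0 := by
  have h : Tendsto (fun t : ℝ => t⁻¹) atTop (𝓝 ((0 : ℚ) : ℝ)) := by
    simpa using tendsto_inv_atTop_zero (𝕜 := ℝ)
  refine h.congr' ?_
  filter_upwards [eventually_eval_inv RatFunc.X_ne_zero] with t ht
  rw [ht, RatFunc.eval_X]

theorem hasLim_inv_X_pow {n : ℕ} (hn : n ≠ 0) : HasLim ((RatFunc.X)⁻¹ ^ n) 0 := by
  obtain ⟨m, rfl⟩ := Nat.exists_eq_succ_of_ne_zero hn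
  induction m with
  | zero => simpa using hasLim_inv_X
  | succ m ih =>
    rw [pow_succ]
    simpa using (ih (Nat.succ_ne_zero m)).mul hasLim_inv_X

/-- Only the products are required to converge: the limit of `A n` may still be unknown when the
matching factor `f 0` vanishes. -/
theorem hasLim_act {A : PLHat (RatFunc ℚ)} {A' : PLHat ℚ} {f : UHat (RatFunc ℚ)} {f' : UHat ℚ}
    {n : ℕ} (h : ∀ i j, i + j = n → ∀ (T : RTree i) (G : Forest j),
      HasLim (A i T * f j G) (A' i T * f' j G)) (S : RTree n) :
    HasLim (act A f n S) (act A' f' n S) := by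
  refine HasLim.sum _ fun p hp => HasLim.sum _ fun T _ => HasLim.sum _ fun G _ => ?_
  have hc := hasLim_const (actCount T G S : ℚ)
  rw [map_natCast] at hc
  exact (h p.1 p.2 (Finset.HasAntidiagonal.mem_antidiagonal.1 hp) T G).mul hc

theorem incl_toRatFunc (A : PLHat ℚ) (n : ℕ) (F : Forest n) :
    incl (toRatFunc A) n F = algebraMap ℚ (RatFunc ℚ) (incl A n F) := by
  rw [incl, incl]
  split
  · rfl
  · rw [map_zero]

theorem starPow_incl_toRatFunc (A : PLHat ℚ) (k : ℕ) : ∀ (n : ℕ) (F : Forest n),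
    starPow (incl (toRatFunc A)) k n F = algebraMap ℚ (RatFunc ℚ) (starPow (incl A) k n F) := by
  induction k with
  | zero =>
    intro n F
    rw [starPow, starPow, oneU, oneU]
    split <;> simp
  | succ k ih =>
    intro n F
    simp only [starPow, starMul, map_sum, map_mul, map_natCast, ih, incl_toRatFunc]

theorem expU_toRatFunc (A : PLHat ℚ) (n : ℕ) (F : Forest n) :
    expU (toRatFunc A) n F = algebraMap ℚ (RatFunc ℚ) (expU A n F) := by
  simp only [expU, powerSeriesAt, map_sum, map_mul, starPow_incl_toRatFunc, PowerSeries.coeff_exp]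
  rfl

theorem hasLim_expU_sub_oneU (A : PLHat ℚ) (n : ℕ) (F : Forest n) :
    HasLim ((expU (toRatFunc A) - oneU : UHat (RatFunc ℚ)) n F) ((expU A - oneU : UHat ℚ) n F) := by
  refine HasLim.sub ?_ ?_
  · rw [expU_toRatFunc]
    exact hasLim_const _
  · rw [oneU, oneU]
    split
    · exact hasLim_one
    · exact hasLim_zero

theorem hasLim_dot (n : ℕ) (T : RTree n) : HasLim (dot n T) (dot n T) := by
  rw [dot, dot]
  split
  · exact hasLim_one
  · exact hasLim_zero

/-! ### The limit of Ω_q[q] / q -/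

/-- The equation of `Ω_q`, rewritten for `Ω_q[q] / q`. -/
theorem IsOmegaQ.shifted {Ω : PLHat ℚ} {Ωq : PLHat (RatFunc ℚ)} (h : IsOmegaQ Ω Ωq)
    {n : ℕ} (T : RTree n) :
    (1 - (RatFunc.X)⁻¹ ^ n) * ((RatFunc.X : RatFunc ℚ)⁻¹ • qShift RatFunc.X Ωq) n T =
      act dot (incl ((RatFunc.X : RatFunc ℚ)⁻¹ • Ωq)) n T + (1 - (RatFunc.X)⁻¹) * dot n T -
      act ((RatFunc.X : RatFunc ℚ)⁻¹ • qShift RatFunc.X Ωq) (expU (toRatFunc Ω) - oneU) n T := by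
  have hX : (RatFunc.X : RatFunc ℚ) ≠ 0 := RatFunc.X_ne_zero
  have h1 : act ((RatFunc.X : RatFunc ℚ)⁻¹ • qShift RatFunc.X Ωq) (expU (toRatFunc Ω) - oneU) n T =
      (RatFunc.X)⁻¹ * act (qShift RatFunc.X Ωq) (expU (toRatFunc Ω) - oneU) n T := by
    simp only [act, Finset.mul_sum, Pi.smul_apply, smul_eq_mul, mul_assoc]
  have h2 : act dot (incl ((RatFunc.X : RatFunc ℚ)⁻¹ • Ωq)) n T =
      (RatFunc.X)⁻¹ * preLie dot Ωq n T := by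
    have hincl : ∀ m (F : Forest m), incl ((RatFunc.X : RatFunc ℚ)⁻¹ • Ωq) m F =
        (RatFunc.X)⁻¹ * incl Ωq m F := by
      intro m F
      rw [incl, incl]
      split
      · rfl
      · rw [mul_zero]
    simp only [preLie, act, Finset.mul_sum, hincl]
    refine Finset.sum_congr rfl fun p _ => Finset.sum_congr rfl fun T _ =>
      Finset.sum_congr rfl fun G _ => ?_
    ring
  have h3 := congrFun (congrFun h n) T
  simp only [Pi.add_apply, Pi.sub_apply, Pi.smul_apply, smul_eq_mul] at h3
  have h4 : qShift RatFunc.X Ωq n T = RatFunc.X ^ n * Ωq n T := rfl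
  rw [h4] at h3
  rw [h1, h2, Pi.smul_apply, Pi.smul_apply, smul_eq_mul, h4]
  have h5 : ((RatFunc.X : RatFunc ℚ))⁻¹ ^ n * RatFunc.X ^ n = 1 := by
    rw [← mul_pow, inv_mul_cancel₀ hX, one_pow]
  have h6 : ((RatFunc.X : RatFunc ℚ))⁻¹ * RatFunc.X = 1 := inv_mul_cancel₀ hX
  linear_combination (RatFunc.X)⁻¹ * h3 - (RatFunc.X)⁻¹ * Ωq n T * h5 + dot n T * h6

theorem IsOmegaQ.hasLim {Ω : PLHat ℚ} (hΩ : IsOmega Ω) {Ωq : PLHat (RatFunc ℚ)}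
    (h : IsOmegaQ Ω Ωq) : ∀ (n : ℕ) (T : RTree n),
      HasLim (((RatFunc.X : RatFunc ℚ)⁻¹ • qShift RatFunc.X Ωq) n T) (altTrees n T) := by
  intro n
  set B := (RatFunc.X : RatFunc ℚ)⁻¹ • qShift RatFunc.X Ωq with hB
  induction n using Nat.strong_induction_on with
  | _ n ih =>
    intro S
    have hn : n ≠ 0 := by
      rintro rfl
      exact isEmptyElim S
    have hlim1 : HasLim (1 - (RatFunc.X)⁻¹ ^ n) 1 := by
      simpa using hasLim_one.sub (hasLim_inv_X_pow hn)
    -- A rational function with limit 1 is not zero.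
    have hne : (1 - (RatFunc.X)⁻¹ ^ n : RatFunc ℚ) ≠ 0 := by
      intro h0
      rw [h0] at hlim1
      have := tendsto_nhds_unique hlim1 hasLim_zero
      norm_num at this
    have hact : HasLim (act B (expU (toRatFunc Ω) - oneU) n S)
        (act altTrees (expU Ω - oneU) n S) := by
      refine hasLim_act (fun i j hij T G => ?_) S
      rcases j with _ | j
      · rw [expU_sub_oneU_zero, expU_sub_oneU_zero, mul_zero, mul_zero]
        exact hasLim_zero
      · exact (ih i (by omega) T).mul (hasLim_expU_sub_oneU Ω _ G)
    -- Degree `j ≥ 1` of Ω_q / q is `q⁻¹ ^ j * B j`, with `B j` convergent by induction, so this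
    -- term tends to 0.
    have hdot : HasLim (act dot (incl ((RatFunc.X : RatFunc ℚ)⁻¹ • Ωq)) n S)
        (act dot (0 : UHat ℚ) n S) := by
      refine hasLim_act (fun i j hij T G => ?_) S
      rcases i with _ | i
      · exact isEmptyElim T
      · refine (hasLim_dot _ T).mul ?_
        rw [incl]
        split
        · next hG =>
          have hj : j ≠ 0 := by
            rintro rfl
            exact G.rep.not_isTree_of_isEmpty hG
          have hBj : ((RatFunc.X : RatFunc ℚ)⁻¹ • Ωq) j ⟨G, hG⟩ =
              (RatFunc.X)⁻¹ ^ j * B j ⟨G, hG⟩ := by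
            have h5 : ((RatFunc.X : RatFunc ℚ))⁻¹ ^ j * RatFunc.X ^ j = 1 := by
              rw [← mul_pow, inv_mul_cancel₀ RatFunc.X_ne_zero, one_pow]
            change (RatFunc.X)⁻¹ * Ωq j ⟨G, hG⟩ =
              (RatFunc.X)⁻¹ ^ j * ((RatFunc.X)⁻¹ * (RatFunc.X ^ j * Ωq j ⟨G, hG⟩))
            linear_combination -(RatFunc.X)⁻¹ * Ωq j ⟨G, hG⟩ * h5
          rw [hBj]
          simpa using (hasLim_inv_X_pow hj).mul (ih j (by omega) ⟨G, hG⟩)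
        · exact hasLim_zero
    have hzero : act dot (0 : UHat ℚ) n S = 0 := by simp [act]
    rw [hzero] at hdot
    -- The signed tree series satisfies the limit of the recursion for `B`, written factor by factor
    -- to match the limits above.
    have hval : altTrees n S =
        1⁻¹ * (0 + (1 - 0) * dot n S - act altTrees (expU Ω - oneU) n S) := by
      have := congrFun (congrFun hΩ.altTrees_add_act n) S
      rw [Pi.add_apply, Pi.add_apply] at this
      rw [← this]
      ring
    have hBS : B n S = _ := (eq_inv_mul_iff_mul_eq₀ hne).2 (h.shifted S)
    rw [hval, hBS]
    exact (hlim1.inv one_ne_zero).mul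
      ((hdot.add ((hasLim_one.sub hasLim_inv_X).mul (hasLim_dot n S))).sub hact)

end RootedTrees

end

theorem mainTheorem8 :
    (∃! Ω : PLHat ℚ, IsOmega Ω) ∧
    ∀ Ω : PLHat ℚ, IsOmega Ω →
      (∃! Ωq : PLHat (RatFunc ℚ), IsOmegaQ Ω Ωq) ∧
      ∀ Ωq : PLHat (RatFunc ℚ), IsOmegaQ Ω Ωq →
        ∃ Ωinf : PLHat ℚ,
          TendsToAtInfinity ((RatFunc.X : RatFunc ℚ)⁻¹ • qShift RatFunc.X Ωq) Ωinf ∧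
          (∀ (n : ℕ) (T : RTree n), Ωinf n T = (-1 : ℚ) ^ (n - 1) / (aut T : ℚ)) ∧
          Ωinf = act dot (expU (-Ω)) :=
  ⟨existsUnique_isOmega, fun Ω hΩ => ⟨existsUnique_isOmegaQ Ω, fun _ h =>
    ⟨altTrees, h.hasLim hΩ, fun _ _ => rfl, hΩ.act_dot_expU_neg.symm⟩⟩⟩
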